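/- **Theorem 3.1.** Let $F$ be the distribution function of a $(0,\infty)$-valued random variable $W$. Suppose that there are constants $\tau>4$ and $c_F>0$ such that $$1-F(x)\le c_F\,x^{-(\tau-1)}\qquad\text{for all }x>0,$$ and that $W$ is critical, i.e. $\nu:=\mathbb E(W^2)/\mathbb E(W)=1$. For $n\ge 1$ and $j\in[n]=\{1,\dots,n\}$ let $w_j=[1-F]^{-1}(j/n)$, where $[1-F]^{-1}(1):=0$ and $[1-F]^{-1}(u):=\inf\{s\in\mathbb R:1-F(s)\le u\}$ for $u\in(0,1)$, and let $l_n=\sum_{i\in[n]}w_i$. Let $NR_n(\mathbf w)$ be the random simple graph on $[n]$ in which the edges are present independently, the edge $\{i,j\}$ ($1\le i<j\le n$) with probability $1-e^{-w_iw_j/l_n}$ (read as $0$ if $l_n=0$), and let $|C_{\max}|$ be the number of vertices of its largest connected component. Then there is a constant $C>0$, depending only on $F$, $\tau$ and $c_F$, such that for every $\omega>1$ there is an $N$ such that for all $n\ge N$ $$\mathbb P\big(|C_{\max}|>\omega n^{2/3}\big)\le\frac{2}{\omega^{3/2}}\left(\frac{\mathbb E(W)}{\mathbb E(W^3)}\vee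 1\right)\left(1+C\,\omega^{-1/2}\,n^{-\frac{\tau-4}{3(\tau-1)}}\right).$$ -/

import Mathlib

open MeasureTheory ProbabilityTheory

namespace NorrosReittu

/-- The generalized inverse `[1-F]⁻¹` of `1 - F`: it is `0` at `u = 1`, and
`inf {s : 1 - F(s) ≤ u}` for `u ∈ (0,1)`. -/
noncomputable def tailInverse (F : ℝ → ℝ) (u : ℝ) : ℝ :=
  if u = 1 then 0 else sInf {s : ℝ | 1 - F s ≤ u}

/-- The vertex weights `w_j = [1-F]⁻¹(j/n)`, `1 ≤ j ≤ n`. The vertex `j ∈ {1, …, n}` is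
represented by the element `j - 1` of `Fin n`. -/
noncomputable def weight (F : ℝ → ℝ) (n : ℕ) (i : Fin n) : ℝ :=
  tailInverse F (((i : ℕ) + 1 : ℝ) / n)

/-- The total weight `l_n`. -/
noncomputable def totalWeight {n : ℕ} (w : Fin n → ℝ) : ℝ := ∑ i, w i

/-- The probability `1 - exp (- w_i w_j / l_n)` that the edge `e = {i, j}` is present. For
nonnegative weights this number lies in `[0,1]`, and the projection onto `[0,1]` does nothing. -/
noncomputable def edgeProb {n : ℕ} (w : Fin n → ℝ) (e : Sym2 (Fin n)) : unitInterval :=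
  Set.projIcc (0 : ℝ) 1 zero_le_one (1 - Real.exp (-((e.map w).mul / totalWeight w)))

/-- The law of the random graph `NR_n(w)` on `n` vertices: all pairs `e` of vertices are declared
present independently, each with probability `edgeProb w e`, and the graph consists of the pairs
of distinct vertices that are present (`SimpleGraph.fromEdgeSet` discards the loops). -/
noncomputable def graphLaw {n : ℕ} (w : Fin n → ℝ) : Measure (SimpleGraph (Fin n)) :=
  (Measure.pi fun e : Sym2 (Fin n) ↦ bernoulliMeasure True False (edgeProb w e)).map
    fun ξ ↦ SimpleGraph.fromEdgeSet {e | ξ e}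

/-- The cluster `C(v)` of the vertex `v`. -/
def cluster {n : ℕ} (G : SimpleGraph (Fin n)) (v : Fin n) : Set (Fin n) := {u | G.Reachable v u}

/-- The size `|C_max| = max_v |C(v)|` of the largest cluster. -/
noncomputable def maxClusterSize {n : ℕ} (G : SimpleGraph (Fin n)) : ℕ :=
  Finset.univ.sup fun v ↦ (cluster G v).ncard

/-- The `k`-th moment `E(W^k)` of a random variable `W` with law `μ`. -/
noncomputable def lawMoment (μ : Measure ℝ) (k : ℕ) : ℝ := ∫ x, x ^ k ∂μ

end NorrosReittu

/-! For each fixed `ω` the bound `2 / ω ^ (3/2)` holds for all large `n`; the maximum and the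
correction factor on the right are at least 1, so they only help.

Markov's inequality for the number of vertices in large clusters gives `x * P(|C_max| > x) ≤ ∑
P(|C(v)| > x)` (`maxClusterSize_tail_mul_le`). Each cluster is dominated by the total progeny of a
branching process in which `v` bears `u` with probability `p s(v, u)` (`cumCoeff_prod_le_explored`).
Its tail is bounded by a multiple of `E (1 - z ^ T) ^ 2 = 1 - 2 g(z) + g(z ^ 2)`, where `T` is the
progeny, `g` its generating function and a defective `T` counts as infinite.

Put `z = exp (-h)`. The size-biased average `y` of `1 - g_v(z)` nearly solves `y = h + ν y - q y ^ 2
/ 2`, with `ν = ∑ w ^ 2 / ∑ w` and `q = ∑ w ^ 3 / ∑ w`. If `ν` is close to 1, then `y ≈ √(2h/q)`.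
With `x = 1 / s ^ 2`, `h = 2 s ^ 2` and `a = s / √q`, the deficits at `z` and `z ^ 2` are about `2a`
and `√8 a`. The tail sum is thus at most about `(4 - √8) / (1 - e⁻²) ^ 2 ≈ 1.57` times `s n`, since
`q` is nearly at least 1 by Jensen and `∑ w ≤ n` (`sum_progeny_le`, `graphLaw_tail_le`). The plain
Markov bound by `1 - g(z)` would give about 2.22 at best, too much for the constant 2; this is why a
second-order quantity is used.

A finite third moment yields `|ν - 1| = o(n ^ (-1/3))` and `max w = o(n ^ (1/3))` for the quantile
weights, so the estimate applies with `s = ω ^ (-1/2) n ^ (-1/3)` (`eventually_graphLaw_tail_le`).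
-/

namespace NorrosReittu

/-! ### Stochastic order on generating polynomials. -/

section CumulativeOrder

open Polynomial

/-- The sum of the coefficients of `f` of degree at most `k`. -/
noncomputable def cumCoeff (f : ℝ[X]) (k : ℕ) : ℝ := ∑ i ∈ Finset.range (k + 1), f.coeff i

/-- Comparison of polynomials through their cumulative coefficients. For generating functions of
laws on `ℕ` this is stochastic domination. -/
def CumLE (f g : ℝ[X]) : Prop := ∀ k, cumCoeff f k ≤ cumCoeff g k

/-- All coefficients are nonnegative. -/
def CoeffNonneg (f : ℝ[X]) : Prop := ∀ i, 0 ≤ f.coeff i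

lemma CumLE.refl (f : ℝ[X]) : CumLE f f := fun _ ↦ le_rfl

lemma CumLE.trans {f g h : ℝ[X]} (hfg : CumLE f g) (hgh : CumLE g h) : CumLE f h :=
  fun k ↦ (hfg k).trans (hgh k)

lemma cumCoeff_add (f g : ℝ[X]) (k : ℕ) : cumCoeff (f + g) k = cumCoeff f k + cumCoeff g k := by
  simp [cumCoeff, Finset.sum_add_distrib]

lemma cumCoeff_C_mul (c : ℝ) (f : ℝ[X]) (k : ℕ) : cumCoeff (C c * f) k = c * cumCoeff f k := by
  simp [cumCoeff, Finset.mul_sum]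

lemma cumCoeff_sum {ι : Type*} (s : Finset ι) (f : ι → ℝ[X]) (k : ℕ) :
    cumCoeff (∑ i ∈ s, f i) k = ∑ i ∈ s, cumCoeff (f i) k := by
  simp only [cumCoeff, finsetSum_coeff]
  exact Finset.sum_comm

lemma cumCoeff_one (k : ℕ) : cumCoeff 1 k = 1 := by
  simp [cumCoeff, Polynomial.coeff_one]

lemma cumCoeff_X_mul_zero (f : ℝ[X]) : cumCoeff (X * f) 0 = 0 := by
  simp [cumCoeff]

lemma cumCoeff_X_mul_succ (f : ℝ[X]) (k : ℕ) : cumCoeff (X * f) (k + 1) = cumCoeff f k := by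
  simp [cumCoeff, Finset.sum_range_succ' _ (k + 1)]

/-- Taking cumulative sums is multiplication by `1 / (1 - X)`, so associativity lets it act on one
factor of a product only. This is what makes the order compatible with products. -/
lemma cumCoeff_eq_coeff_mul (f : ℝ[X]) (k : ℕ) :
    cumCoeff f k = PowerSeries.coeff k ((f : PowerSeries ℝ) * PowerSeries.mk 1) := by
  rw [PowerSeries.coeff_mul, Finset.Nat.sum_antidiagonal_eq_sum_range_succ_mk]
  simp [cumCoeff]

lemma cumCoeff_mul (h f : ℝ[X]) (k : ℕ) :
    cumCoeff (h * f) k =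
      ∑ x ∈ Finset.HasAntidiagonal.antidiagonal k, h.coeff x.1 * cumCoeff f x.2 := by
  rw [cumCoeff_eq_coeff_mul, Polynomial.coe_mul, mul_assoc, PowerSeries.coeff_mul]
  simp [cumCoeff_eq_coeff_mul]

lemma CumLE.mul_left {f g h : ℝ[X]} (hfg : CumLE f g) (hh : CoeffNonneg h) :
    CumLE (h * f) (h * g) := fun k ↦ by
  rw [cumCoeff_mul, cumCoeff_mul]
  exact Finset.sum_le_sum fun x _ ↦ mul_le_mul_of_nonneg_left (hfg _) (hh _)

lemma CoeffNonneg.mul {f g : ℝ[X]} (hf : CoeffNonneg f) (hg : CoeffNonneg g) :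
    CoeffNonneg (f * g) := fun i ↦ by
  rw [Polynomial.coeff_mul]
  exact Finset.sum_nonneg fun x _ ↦ mul_nonneg (hf _) (hg _)

lemma CoeffNonneg.add {f g : ℝ[X]} (hf : CoeffNonneg f) (hg : CoeffNonneg g) :
    CoeffNonneg (f + g) := fun i ↦ by
  rw [Polynomial.coeff_add]
  exact add_nonneg (hf _) (hg _)

lemma coeffNonneg_C {c : ℝ} (hc : 0 ≤ c) : CoeffNonneg (C c) := fun i ↦ by
  rw [Polynomial.coeff_C]; split_ifs <;> simp [hc]

lemma coeffNonneg_X : CoeffNonneg X := fun i ↦ by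
  rw [Polynomial.coeff_X]; split_ifs <;> simp

lemma coeffNonneg_one : CoeffNonneg 1 := coeffNonneg_C zero_le_one

lemma CoeffNonneg.prod {ι : Type*} {s : Finset ι} {f : ι → ℝ[X]}
    (hf : ∀ i ∈ s, CoeffNonneg (f i)) : CoeffNonneg (∏ i ∈ s, f i) :=
  Finset.prod_induction _ _ (fun _ _ ↦ CoeffNonneg.mul) coeffNonneg_one hf

lemma CumLE.prod_one {ι : Type*} [DecidableEq ι] {s : Finset ι} {f : ι → ℝ[X]}
    (hf : ∀ i ∈ s, CoeffNonneg (f i)) (hf1 : ∀ i ∈ s, CumLE (f i) 1) :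
    CumLE (∏ i ∈ s, f i) 1 := by
  induction s using Finset.induction_on with
  | empty => simpa using CumLE.refl 1
  | insert a s ha ih =>
    rw [Finset.prod_insert ha]
    have h1 := (ih (fun i hi ↦ hf i (Finset.mem_insert_of_mem hi))
      fun i hi ↦ hf1 i (Finset.mem_insert_of_mem hi)).mul_left (hf a (Finset.mem_insert_self _ _))
    rw [mul_one] at h1
    exact h1.trans (hf1 a (Finset.mem_insert_self _ _))

/-- Dropping factors increases the product in the cumulative order. -/
lemma CumLE.prod_mul_prod_le_union {ι : Type*} [DecidableEq ι] {f : ι → ℝ[X]}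
    (hf : ∀ i, CoeffNonneg (f i)) (hf1 : ∀ i, CumLE (f i) 1) (s t : Finset ι) :
    CumLE ((∏ i ∈ s, f i) * ∏ i ∈ t, f i) (∏ i ∈ s ∪ t, f i) := by
  rw [← Finset.prod_union_inter]
  simpa using (CumLE.prod_one (s := s ∩ t) (fun i _ ↦ hf i) fun i _ ↦ hf1 i).mul_left
    (CoeffNonneg.prod (s := s ∪ t) fun i _ ↦ hf i)

lemma CumLE.prod_le_prod_subset {ι : Type*} [DecidableEq ι] {f : ι → ℝ[X]}
    (hf : ∀ i, CoeffNonneg (f i)) (hf1 : ∀ i, CumLE (f i) 1) {s t : Finset ι} (hst : s ⊆ t) :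
    CumLE (∏ i ∈ t, f i) (∏ i ∈ s, f i) := by
  rw [← Finset.prod_sdiff hst, mul_comm]
  simpa using (CumLE.prod_one (s := t \ s) (fun i _ ↦ hf i) fun i _ ↦ hf1 i).mul_left
    (CoeffNonneg.prod (s := s) fun i _ ↦ hf i)

lemma cumCoeff_le_eval_one {f : ℝ[X]} (hf : CoeffNonneg f) (k : ℕ) : cumCoeff f k ≤ f.eval 1 := by
  rw [Polynomial.eval_eq_sum_range' (n := max (k + 1) (f.natDegree + 1)) (by omega)]
  simp only [one_pow, mul_one]
  exact Finset.sum_le_sum_of_subset_of_nonneg (by simp) fun i _ _ ↦ hf i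

lemma cumLE_of_coeff_le {f g : ℝ[X]} (h : ∀ i, f.coeff i ≤ g.coeff i) : CumLE f g :=
  fun _ ↦ Finset.sum_le_sum fun i _ ↦ h i

end CumulativeOrder

/-! ### Cluster exploration and its domination by a branching process. -/

section Exploration

variable {V : Type*}

/-- The vertices that can be reached from `A` by open edges inside `S`. -/
def explored (ξ : Sym2 V → Prop) (S A : Finset V) : Set V :=
  {u | ∃ a ∈ A, Relation.ReflTransGen (fun x y ↦ x ∈ S ∧ y ∈ S ∧ ξ s(x, y)) a u}

lemma explored_empty (ξ : Sym2 V → Prop) (S : Finset V) : explored ξ S ∅ = ∅ := by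
  simp [explored]

-- One exploration step: `a` is removed from the graph, and its neighbours become active in its
-- place.
open Classical in
lemma explored_subset_insert [DecidableEq V] (ξ : Sym2 V → Prop) (S A : Finset V) (a : V) :
    explored ξ S A ⊆ insert a (explored ξ (S.erase a)
      (A.erase a ∪ {u ∈ S.erase a | ξ s(a, u)})) := by
  rintro u ⟨b, hb, hbu⟩
  induction hbu with
  | refl =>
    by_cases hba : b = a
    · exact Or.inl hba
    · exact Or.inr ⟨b, Finset.mem_union_left _ (Finset.mem_erase.2 ⟨hba, hb⟩), .refl⟩
  | @tail x y _ hxy ih =>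
    obtain ⟨hx, hy, hξ⟩ := hxy
    by_cases hya : y = a
    · exact Or.inl hya
    right
    by_cases hxa : x = a
    · subst hxa
      exact ⟨y, by simp [hya, hy, hξ], .refl⟩
    · obtain ⟨c, hc, hcx⟩ := ih.resolve_left hxa
      exact ⟨c, hc, hcx.tail ⟨by simp [hxa, hx], by simp [hya, hy], hξ⟩⟩

/-- The exploration reads only edges inside `S`; this locality is the source of its independence
from the edges at a removed vertex. -/
lemma explored_congr {ξ ξ' : Sym2 V → Prop} {S : Finset V} (h : ∀ e ∈ S.sym2, ξ e ↔ ξ' e)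
    (A : Finset V) : explored ξ S A = explored ξ' S A := by
  have : (fun x y ↦ x ∈ S ∧ y ∈ S ∧ ξ s(x, y)) = fun x y ↦ x ∈ S ∧ y ∈ S ∧ ξ' s(x, y) := by
    ext x y
    refine and_congr_right fun hx ↦ and_congr_right fun hy ↦ h _ ?_
    simp [hx, hy]
  simp [explored, this]

variable [Fintype V]

/-- The law of independent Bernoulli edges. -/
noncomputable def edgeLaw (p : Sym2 V → unitInterval) : Measure (Sym2 V → Prop) :=
  Measure.pi fun e ↦ bernoulliMeasure True False (p e)

instance (p : Sym2 V → unitInterval) : IsProbabilityMeasure (edgeLaw p) := by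
  unfold edgeLaw; infer_instance

lemma measurableSet_edgeConfig (E : Set (Sym2 V → Prop)) : MeasurableSet E :=
  E.toFinite.measurableSet

lemma iIndepFun_edgeLaw (p : Sym2 V → unitInterval) :
    iIndepFun (fun e (ξ : Sym2 V → Prop) ↦ ξ e) (edgeLaw p) :=
  iIndepFun_pi (X := fun _ q ↦ q) fun _ ↦ aemeasurable_id

lemma edgeLaw_eval (p : Sym2 V → unitInterval) (e : Sym2 V) (b : Prop) [Decidable b] :
    (edgeLaw p).real {ξ | ξ e ↔ b} = if b then (p e : ℝ) else 1 - p e := by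
  classical
  have h : (edgeLaw p).map (fun ξ ↦ ξ e) = bernoulliMeasure True False (p e) :=
    (measurePreserving_eval (fun e ↦ bernoulliMeasure True False (p e)) e).map_eq
  have h2 : {ξ : Sym2 V → Prop | ξ e ↔ b} = (fun ξ ↦ ξ e) ⁻¹' {q | q ↔ b} := rfl
  rw [h2, ← map_measureReal_apply (measurable_pi_apply e) (Set.toFinite _).measurableSet, h,
    bernoulliMeasure_real_apply _ (Set.toFinite _).measurableSet]
  by_cases hb : b <;> simp [hb]

variable [DecidableEq V]

/-- The law of the set of neighbours in `T` of a vertex `a ∉ T`. -/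
lemma edgeLaw_neighbors (p : Sym2 V → unitInterval) (a : V) {T N : Finset V} (hN : N ⊆ T) :
    (edgeLaw p).real {ξ | ∀ u ∈ T, ξ s(a, u) ↔ u ∈ N}
      = (∏ u ∈ N, (p s(a, u) : ℝ)) * ∏ u ∈ T \ N, (1 - p s(a, u) : ℝ) := by
  have hinj : Function.Injective fun u : V ↦ s(a, u) := fun x y h ↦ Sym2.congr_right.1 h
  have h := (iIndepFun_edgeLaw p).measure_inter_preimage_eq_mul
    (T.image fun u ↦ s(a, u)) (sets := fun e ↦ {q | q ↔ e ∈ N.image fun u ↦ s(a, u)})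
    (fun _ _ ↦ (Set.toFinite _).measurableSet)
  have hset : {ξ : Sym2 V → Prop | ∀ u ∈ T, ξ s(a, u) ↔ u ∈ N} =
      ⋂ e ∈ T.image fun u ↦ s(a, u),
        (fun ξ : Sym2 V → Prop ↦ ξ e) ⁻¹' {q | q ↔ e ∈ N.image fun u ↦ s(a, u)} := by
    ext ξ
    simp only [Set.mem_ofPred_eq, Set.mem_iInter, Finset.mem_image, Set.mem_preimage]
    constructor
    · rintro h _ ⟨u, hu, rfl⟩
      rw [h u hu]
      exact ⟨fun hu ↦ ⟨u, hu, rfl⟩, fun ⟨v, hv, hvu⟩ ↦ hinj hvu ▸ hv⟩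
    · intro h u hu
      rw [h _ ⟨u, hu, rfl⟩]
      exact ⟨fun ⟨v, hv, hvu⟩ ↦ hinj hvu ▸ hv, fun hu ↦ ⟨u, hu, rfl⟩⟩
  rw [measureReal_def, hset, h, ENNReal.toReal_prod, Finset.prod_image hinj.injOn]
  have hev (u : V) : (edgeLaw p).real ((fun ξ : Sym2 V → Prop ↦ ξ s(a, u)) ⁻¹'
      {q | q ↔ s(a, u) ∈ N.image fun u ↦ s(a, u)})
      = if u ∈ N then (p s(a, u) : ℝ) else 1 - p s(a, u) := by
    rw [← edgeLaw_eval p s(a, u) (u ∈ N)]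
    simp only [hinj.mem_finset_image]
    rfl
  simp only [measureReal_def] at hev
  simp only [hev]
  rw [← Finset.prod_sdiff hN, mul_comm]
  congr 1
  · exact Finset.prod_congr rfl fun u hu ↦ if_pos hu
  · exact Finset.prod_congr rfl fun u hu ↦ if_neg (Finset.mem_sdiff.1 hu).2

/-- The neighbours of `a` are independent of the edges between the other vertices. -/
lemma edgeLaw_inter (p : Sym2 V → unitInterval) {a : V} {T : Finset V} (ha : a ∉ T)
    (N B : Finset V) (k : ℕ) :
    (edgeLaw p).real ({ξ | ∀ u ∈ T, ξ s(a, u) ↔ u ∈ N} ∩ {ξ | (explored ξ T B).ncard ≤ k})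
      = (edgeLaw p).real {ξ | ∀ u ∈ T, ξ s(a, u) ↔ u ∈ N}
        * (edgeLaw p).real {ξ | (explored ξ T B).ncard ≤ k} := by
  classical
  have hdisj : Disjoint (T.image fun u ↦ s(a, u)) T.sym2 := by
    rw [Finset.disjoint_left]
    intro e he he'
    obtain ⟨u, hu, rfl⟩ := Finset.mem_image.1 he
    simp [ha] at he'
  have hind := (iIndepFun_edgeLaw p).indepFun_finset _ _ hdisj (fun e ↦ measurable_pi_apply e)
  set X := fun (ξ : Sym2 V → Prop) (i : (T.image fun u ↦ s(a, u) : Finset (Sym2 V))) ↦ ξ i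
  set Y := fun (ξ : Sym2 V → Prop) (i : (T.sym2 : Finset (Sym2 V))) ↦ ξ i
  have hE1 : {ξ : Sym2 V → Prop | ∀ u ∈ T, ξ s(a, u) ↔ u ∈ N} =
      X ⁻¹' (X '' {ξ | ∀ u ∈ T, ξ s(a, u) ↔ u ∈ N}) := by
    refine subset_antisymm (Set.subset_preimage_image _ _) ?_
    rintro ξ ⟨ξ', h, hX⟩ u hu
    rw [← h u hu]
    have := congrFun hX ⟨s(a, u), Finset.mem_image_of_mem _ hu⟩
    exact iff_of_eq this.symm
  have hE2 : {ξ : Sym2 V → Prop | (explored ξ T B).ncard ≤ k} =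
      Y ⁻¹' (Y '' {ξ | (explored ξ T B).ncard ≤ k}) := by
    refine subset_antisymm (Set.subset_preimage_image _ _) ?_
    rintro ξ ⟨ξ', h, hY⟩
    have : explored ξ' T B = explored ξ T B :=
      explored_congr (fun e he ↦ iff_of_eq (congrFun hY ⟨e, he⟩)) B
    simpa [← this] using h
  rw [hE1, hE2]
  simp only [measureReal_def]
  rw [hind.measure_inter_preimage_eq_mul _ _ (Set.toFinite _).measurableSet
    (Set.toFinite _).measurableSet, ENNReal.toReal_mul]

open Polynomial in
/-- The exploration of `A` inside `S` is stochastically dominated by independent branching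
processes whose (possibly defective) total progenies have the generating functions `G v`. -/
theorem cumCoeff_prod_le_explored (p : Sym2 V → unitInterval) {G : V → ℝ[X]}
    (hG : ∀ v, CoeffNonneg (G v)) (hG1 : ∀ v, CumLE (G v) 1)
    (hsub : ∀ a, CumLE (G a) (X * ∏ u, (C (1 - p s(a, u) : ℝ) + C (p s(a, u) : ℝ) * G u)))
    (S : Finset V) : ∀ A ⊆ S, ∀ k : ℕ, cumCoeff (∏ v ∈ A, G v) k
      ≤ (edgeLaw p).real {ξ | (explored ξ S A).ncard ≤ k} := by
  classical
  induction hn : S.card generalizing S with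
  | zero =>
    intro A hA k
    obtain rfl : A = ∅ := by rw [Finset.card_eq_zero.1 hn] at hA; exact Finset.subset_empty.1 hA
    simp [explored_empty, cumCoeff_one]
  | succ m ih =>
    intro A hA k
    obtain rfl | ⟨a, ha⟩ := A.eq_empty_or_nonempty
    · simp [explored_empty, cumCoeff_one]
    set T := S.erase a with hT
    have haT : a ∉ T := Finset.notMem_erase _ _
    have hTcard : T.card = m := by rw [Finset.card_erase_of_mem (hA ha), hn]; rfl
    have hfac (u : V) : CoeffNonneg (C (1 - p s(a, u) : ℝ) + C (p s(a, u) : ℝ) * G u) :=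
      (coeffNonneg_C (by linarith [(p s(a, u)).2.2])).add
        ((coeffNonneg_C (p s(a, u)).2.1).mul (hG u))
    have hfac1 (u : V) : CumLE (C (1 - p s(a, u) : ℝ) + C (p s(a, u) : ℝ) * G u) 1 := fun k ↦ by
      have h1 := hG1 u k
      have h2 := cumCoeff_C_mul (1 - p s(a, u) : ℝ) 1 k
      rw [mul_one] at h2
      rw [cumCoeff_add, h2, cumCoeff_C_mul]
      rw [cumCoeff_one] at h1 ⊢
      nlinarith [(p s(a, u)).2.1]
    have hprod : CoeffNonneg (∏ v ∈ A.erase a, G v) := CoeffNonneg.prod fun v _ ↦ hG v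
    have hstep : CumLE (∏ v ∈ A, G v) (X * ((∏ v ∈ A.erase a, G v)
        * ∏ u ∈ T, (C (1 - p s(a, u) : ℝ) + C (p s(a, u) : ℝ) * G u))) := by
      rw [← Finset.prod_erase_mul _ _ ha]
      refine ((hsub a).mul_left hprod).trans ?_
      rw [mul_left_comm]
      refine CumLE.mul_left (CumLE.mul_left ?_ hprod) coeffNonneg_X
      -- Letting `a` bear all vertices, itself and removed ones included, only enlarges the progeny;
      -- it makes the offspring product run over all of `V`.
      exact CumLE.prod_le_prod_subset hfac hfac1 (Finset.subset_univ T)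
    refine (hstep k).trans ?_
    cases k with
    | zero => rw [cumCoeff_X_mul_zero]; exact measureReal_nonneg
    | succ k =>
      rw [cumCoeff_X_mul_succ]
      -- The events split according to the exact neighbourhood `N` of `a` in `T`, matching the
      -- expansion of the offspring product over subsets.
      set E : Finset V → Set (Sym2 V → Prop) := fun N ↦
        {ξ | ∀ u ∈ T, ξ s(a, u) ↔ u ∈ N} ∩ {ξ | (explored ξ T (A.erase a ∪ N)).ncard ≤ k}
      have hsubset : (⋃ N ∈ T.powerset, E N) ⊆ {ξ | (explored ξ S A).ncard ≤ k + 1} := by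
        simp only [Set.iUnion_subset_iff, Finset.mem_powerset]
        rintro N hN ξ ⟨h1, h2⟩
        have hNeq : T.filter (fun u ↦ ξ s(a, u)) = N := by
          ext u
          simp only [Finset.mem_filter]
          exact ⟨fun h ↦ (h1 u h.1).1 h.2, fun h ↦ ⟨hN h, (h1 u (hN h)).2 h⟩⟩
        have h3 := explored_subset_insert ξ S A a
        rw [← hT, hNeq] at h3
        calc (explored ξ S A).ncard ≤ _ := Set.ncard_le_ncard h3 (Set.toFinite _)
          _ ≤ _ := Set.ncard_insert_le _ _
          _ ≤ k + 1 := Nat.add_le_add_right h2 1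
      have hdisj : (T.powerset : Set (Finset V)).PairwiseDisjoint E := by
        intro N hN N' hN' hne
        rw [Function.onFun, Set.disjoint_left]
        rintro ξ ⟨h1, -⟩ ⟨h2, -⟩
        apply hne
        ext u
        constructor
        · intro hu
          have huT : u ∈ T := Finset.mem_powerset.1 hN hu
          exact (h2 u huT).1 ((h1 u huT).2 hu)
        · intro hu
          have huT : u ∈ T := Finset.mem_powerset.1 hN' hu
          exact (h1 u huT).1 ((h2 u huT).2 hu)
      calc _ = ∑ N ∈ T.powerset, ((∏ u ∈ N, (p s(a, u) : ℝ)) * ∏ u ∈ T \ N, (1 - p s(a, u) : ℝ))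
            * cumCoeff ((∏ v ∈ A.erase a, G v) * ∏ u ∈ N, G u) k := by
            have : ∏ u ∈ T, (C (1 - p s(a, u) : ℝ) + C (p s(a, u) : ℝ) * G u) =
                ∑ N ∈ T.powerset, C ((∏ u ∈ N, (p s(a, u) : ℝ))
                  * ∏ u ∈ T \ N, (1 - p s(a, u) : ℝ)) * ∏ u ∈ N, G u := by
              simp_rw [add_comm (C (1 - _ : ℝ)), Finset.prod_add, Finset.prod_mul_distrib,
                ← map_prod, C_mul]
              exact Finset.sum_congr rfl fun N _ ↦ by ring
            rw [this, Finset.mul_sum, cumCoeff_sum]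
            refine Finset.sum_congr rfl fun N _ ↦ ?_
            rw [mul_left_comm, cumCoeff_C_mul]
        _ ≤ ∑ N ∈ T.powerset, (edgeLaw p).real (E N) := by
            refine Finset.sum_le_sum fun N hN ↦ ?_
            rw [Finset.mem_powerset] at hN
            rw [edgeLaw_inter p haT, edgeLaw_neighbors p a hN]
            refine mul_le_mul_of_nonneg_left ?_ (mul_nonneg
              (Finset.prod_nonneg fun u _ ↦ (p s(a, u)).2.1)
              (Finset.prod_nonneg fun u _ ↦ by linarith [(p s(a, u)).2.2]))
            -- A vertex in both `N` and `A.erase a` starts two branching processes but is explored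
            -- once.
            refine (CumLE.prod_mul_prod_le_union hG hG1 _ _ k).trans ?_
            exact ih T hTcard _ (Finset.union_subset (Finset.erase_subset_erase a hA) hN) k
        _ = (edgeLaw p).real (⋃ N ∈ T.powerset, E N) :=
            (measureReal_biUnion_finset hdisj fun N _ ↦ measurableSet_edgeConfig _).symm
        _ ≤ _ := measureReal_mono hsubset

end Exploration
-- Total progeny and a second-order tail bound.
section Progeny

open Polynomial Filter Topology

lemma CumLE.mul {f f' g g' : ℝ[X]} (hf : CumLE f f') (hg : CumLE g g') (hf' : CoeffNonneg f')
    (hg0 : CoeffNonneg g) : CumLE (f * g) (f' * g') := by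
  have h := hf.mul_left hg0
  rw [mul_comm g, mul_comm g] at h
  exact h.trans (hg.mul_left hf')

lemma CumLE.prod {ι : Type*} (s : Finset ι) {f g : ι → ℝ[X]} (h : ∀ i, CumLE (f i) (g i))
    (hf : ∀ i, CoeffNonneg (f i)) (hg : ∀ i, CoeffNonneg (g i)) :
    CumLE (∏ i ∈ s, f i) (∏ i ∈ s, g i) := by
  classical
  induction s using Finset.induction_on with
  | empty => simpa using CumLE.refl 1
  | insert a s ha ih =>
    rw [Finset.prod_insert ha, Finset.prod_insert ha]
    exact (h a).mul ih (hg a) (CoeffNonneg.prod fun i _ ↦ hf i)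

/-- A second order Markov inequality for a generating function. -/
lemma one_sub_cumCoeff_le {f : ℝ[X]} (hf : CoeffNonneg f) (hf1 : f.eval 1 ≤ 1) {z b : ℝ}
    (hz0 : 0 ≤ z) (hz1 : z ≤ 1) {k : ℕ} (hb0 : 0 ≤ b) (hb : 1 ≤ b * (1 - z ^ (k + 1)) ^ 2) :
    1 - cumCoeff f k ≤ b * (1 - 2 * f.eval z + f.eval (z ^ 2)) := by
  set N := max (k + 1) (f.natDegree + 1)
  have hN : f.natDegree < N := by omega
  rw [eval_eq_sum_range' hN] at hf1 ⊢
  rw [eval_eq_sum_range' hN]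
  have hzk0 : 0 ≤ z ^ (k + 1) := by positivity
  have hzk1 : z ^ (k + 1) ≤ 1 := pow_le_one₀ hz0 hz1
  -- Needed for the missing mass `1 - f.eval 1`, which the right side counts with weight `b`.
  have hb1 : 1 ≤ b :=
    hb.trans (mul_le_of_le_one_right hb0 (pow_le_one₀ (by linarith) (by linarith)))
  have hcum : cumCoeff f k = ∑ i ∈ Finset.range N, if i < k + 1 then f.coeff i else 0 := by
    rw [← Finset.sum_filter, cumCoeff]
    congr 1
    ext i
    simp only [Finset.mem_range, Finset.mem_filter]
    omega
  have hkey : ∑ i ∈ Finset.range N, (f.coeff i - if i < k + 1 then f.coeff i else 0)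
      ≤ ∑ i ∈ Finset.range N, b * (f.coeff i * (1 - z ^ i) ^ 2) := by
    refine Finset.sum_le_sum fun i _ ↦ ?_
    have hi := hf i
    split_ifs with h
    · rw [sub_self]; positivity
    · have hzi : z ^ i ≤ z ^ (k + 1) := pow_le_pow_of_le_one hz0 hz1 (by omega)
      have : (1 - z ^ (k + 1)) ^ 2 ≤ (1 - z ^ i) ^ 2 := by
        apply pow_le_pow_left₀ <;> linarith
      have : 1 ≤ b * (1 - z ^ i) ^ 2 := hb.trans (mul_le_mul_of_nonneg_left this hb0)
      nlinarith
  rw [Finset.sum_sub_distrib, ← hcum, ← Finset.mul_sum] at hkey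
  have hexp : ∑ i ∈ Finset.range N, f.coeff i * (1 - z ^ i) ^ 2
      = ∑ i ∈ Finset.range N, f.coeff i * 1 ^ i - 2 * ∑ i ∈ Finset.range N, f.coeff i * z ^ i
        + ∑ i ∈ Finset.range N, f.coeff i * (z ^ 2) ^ i := by
    rw [Finset.mul_sum, ← Finset.sum_sub_distrib, ← Finset.sum_add_distrib]
    refine Finset.sum_congr rfl fun i _ ↦ ?_
    rw [← pow_mul, mul_comm 2 i, pow_mul]
    ring
  rw [hexp] at hkey
  simp only [one_pow, mul_one] at hkey hf1
  nlinarith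

variable {V : Type*} [Fintype V]

/-- The generating function of the total progeny of the branching process in which an individual
`v` has a child `u` with probability `p s(v, u)`, on the event that its height is less than `j`. -/
noncomputable def progenyGF (p : Sym2 V → unitInterval) : ℕ → V → ℝ[X]
  | 0 => fun _ ↦ 0
  | j + 1 => fun v ↦ X * ∏ u, (C (1 - p s(v, u) : ℝ) + C (p s(v, u) : ℝ) * progenyGF p j u)

variable (p : Sym2 V → unitInterval)

lemma coeffNonneg_progenyGF (j : ℕ) (v : V) : CoeffNonneg (progenyGF p j v) := by
  induction j generalizing v with
  | zero => exact fun i ↦ by simp [progenyGF]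
  | succ j ih =>
    refine coeffNonneg_X.mul (CoeffNonneg.prod fun u _ ↦ ?_)
    exact (coeffNonneg_C (by linarith [(p s(v, u)).2.2])).add
      ((coeffNonneg_C (p s(v, u)).2.1).mul (ih u))

/-- This supplies the one-step inequality required by `cumCoeff_prod_le_explored`: truncating at
height `j` keeps polynomials and needs no exact fixed point. -/
lemma cumLE_progenyGF_succ (j : ℕ) (v : V) :
    CumLE (progenyGF p j v) (progenyGF p (j + 1) v) := by
  induction j generalizing v with
  | zero =>
    refine cumLE_of_coeff_le fun i ↦ ?_
    simpa only [progenyGF, coeff_zero] using coeffNonneg_progenyGF p 1 v i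
  | succ j ih =>
    have hn (j : ℕ) (u : V) :
        CoeffNonneg (C (1 - p s(v, u) : ℝ) + C (p s(v, u) : ℝ) * progenyGF p j u) :=
      (coeffNonneg_C (by linarith [(p s(v, u)).2.2])).add
        ((coeffNonneg_C (p s(v, u)).2.1).mul (coeffNonneg_progenyGF p j u))
    refine (CumLE.prod _ (fun u k ↦ ?_) (hn j) (hn (j + 1))).mul_left coeffNonneg_X
    rw [cumCoeff_add, cumCoeff_add, cumCoeff_C_mul, cumCoeff_C_mul]
    linarith [mul_le_mul_of_nonneg_left (ih u k) (p s(v, u)).2.1]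

lemma eval_progenyGF_succ (j : ℕ) (v : V) (z : ℝ) : (progenyGF p (j + 1) v).eval z
    = z * ∏ u, (1 - p s(v, u) + p s(v, u) * (progenyGF p j u).eval z : ℝ) := by
  simp [progenyGF, eval_prod]

lemma eval_progenyGF_mem {z : ℝ} (hz0 : 0 ≤ z) (hz1 : z ≤ 1) (j : ℕ) (v : V) :
    (progenyGF p j v).eval z ∈ Set.Icc (0 : ℝ) 1 := by
  induction j generalizing v with
  | zero => simp [progenyGF]
  | succ j ih =>
    rw [eval_progenyGF_succ]
    have h0 (u : V) : 0 ≤ (1 - p s(v, u) + p s(v, u) * (progenyGF p j u).eval z : ℝ) := by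
      nlinarith [(p s(v, u)).2.1, (p s(v, u)).2.2, (ih u).1]
    have h1 (u : V) : (1 - p s(v, u) + p s(v, u) * (progenyGF p j u).eval z : ℝ) ≤ 1 := by
      nlinarith [(p s(v, u)).2.1, (ih u).2]
    have h2 := Finset.prod_nonneg fun u (_ : u ∈ Finset.univ) ↦ h0 u
    have h3 := Finset.prod_le_one (s := Finset.univ) (fun u _ ↦ h0 u) fun u _ ↦ h1 u
    exact ⟨mul_nonneg hz0 h2, mul_le_one₀ hz1 h2 h3⟩

lemma monotone_eval_progenyGF {z : ℝ} (hz0 : 0 ≤ z) (hz1 : z ≤ 1) (v : V) :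
    Monotone fun j ↦ (progenyGF p j v).eval z := by
  refine monotone_nat_of_le_succ fun j ↦ ?_
  induction j generalizing v with
  | zero => simpa [progenyGF] using (eval_progenyGF_mem p hz0 hz1 1 v).1
  | succ j ih =>
    rw [eval_progenyGF_succ, eval_progenyGF_succ]
    refine mul_le_mul_of_nonneg_left (Finset.prod_le_prod (fun u _ ↦ ?_) fun u _ ↦ ?_) hz0
    · nlinarith [(p s(v, u)).2.1, (p s(v, u)).2.2, (eval_progenyGF_mem p hz0 hz1 j u).1]
    · linarith [mul_le_mul_of_nonneg_left (ih u) (p s(v, u)).2.1]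

/-- The generating function of the total progeny started from `v`. -/
noncomputable def progeny (z : ℝ) (v : V) : ℝ := ⨆ j, (progenyGF p j v).eval z

lemma tendsto_progeny {z : ℝ} (hz0 : 0 ≤ z) (hz1 : z ≤ 1) (v : V) :
    Tendsto (fun j ↦ (progenyGF p j v).eval z) atTop (𝓝 (progeny p z v)) :=
  tendsto_atTop_ciSup (monotone_eval_progenyGF p hz0 hz1 v)
    ⟨1, by rintro _ ⟨j, rfl⟩; exact (eval_progenyGF_mem p hz0 hz1 j v).2⟩

lemma progeny_mem {z : ℝ} (hz0 : 0 ≤ z) (hz1 : z ≤ 1) (v : V) :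
    progeny p z v ∈ Set.Icc (0 : ℝ) 1 :=
  isClosed_Icc.mem_of_tendsto (tendsto_progeny p hz0 hz1 v)
    (Eventually.of_forall fun j ↦ eval_progenyGF_mem p hz0 hz1 j v)

lemma progeny_eq {z : ℝ} (hz0 : 0 ≤ z) (hz1 : z ≤ 1) (v : V) :
    progeny p z v = z * ∏ u, (1 - p s(v, u) + p s(v, u) * progeny p z u : ℝ) := by
  refine tendsto_nhds_unique ((tendsto_add_atTop_iff_nat 1).2 (tendsto_progeny p hz0 hz1 v)) ?_
  simp_rw [eval_progenyGF_succ]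
  exact (tendsto_finsetProd _ fun u _ ↦
    ((tendsto_progeny p hz0 hz1 u).const_mul _).const_add _).const_mul z

variable [DecidableEq V]

/-- A tail bound for the size of an explored cluster. -/
theorem explored_tail_le (v : V) {z b : ℝ} (hz0 : 0 ≤ z) (hz1 : z ≤ 1) {k : ℕ}
    (hb0 : 0 ≤ b) (hb : 1 ≤ b * (1 - z ^ (k + 1)) ^ 2) :
    (edgeLaw p).real {ξ | k < (explored ξ Finset.univ {v}).ncard}
      ≤ b * (1 - 2 * progeny p z v + progeny p (z ^ 2) v) := by
  have hz2 : z ^ 2 ≤ 1 := pow_le_one₀ hz0 hz1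
  have hcompl : {ξ : Sym2 V → Prop | k < (explored ξ Finset.univ {v}).ncard}
      = {ξ | (explored ξ Finset.univ {v}).ncard ≤ k}ᶜ := by ext; simp
  rw [hcompl, probReal_compl_eq_one_sub (measurableSet_edgeConfig _)]
  -- The probability does not depend on the truncation height `j`, so the bound passes to the limit.
  refine ge_of_tendsto' ((((tendsto_progeny p hz0 hz1 v).const_mul 2).const_sub 1).add
    (tendsto_progeny p (sq_nonneg z) hz2 v) |>.const_mul b) fun j ↦ ?_
  have h1 (u : V) : (progenyGF p j u).eval 1 ≤ 1 :=
    (eval_progenyGF_mem p zero_le_one le_rfl j u).2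
  have h2 := cumCoeff_prod_le_explored p (coeffNonneg_progenyGF p j)
    (fun u k ↦ by
      rw [cumCoeff_one]
      exact (cumCoeff_le_eval_one (coeffNonneg_progenyGF p j u) k).trans (h1 u))
    (fun a ↦ cumLE_progenyGF_succ p j a) Finset.univ {v} (Finset.subset_univ _) k
  rw [Finset.prod_singleton] at h2
  linarith [one_sub_cumCoeff_le (coeffNonneg_progenyGF p j v) (h1 v) hz0 hz1 hb0 hb]

end Progeny

/-! ### From single clusters to the largest one. -/

section LargestCluster

variable {n : ℕ}

lemma cluster_subset_explored (ξ : Sym2 (Fin n) → Prop) (v : Fin n) :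
    cluster (SimpleGraph.fromEdgeSet {e | ξ e}) v ⊆ explored ξ Finset.univ {v} := by
  intro u hu
  refine ⟨v, by simp, ?_⟩
  have h := (SimpleGraph.reachable_iff_reflTransGen v u).1 hu
  refine Relation.ReflTransGen.mono (fun x y hxy ↦ ?_) _ _ h
  simpa using ((SimpleGraph.fromEdgeSet_adj _).1 hxy).1

lemma cluster_eq_of_mem {G : SimpleGraph (Fin n)} {u v : Fin n} (hu : u ∈ cluster G v) :
    cluster G u = cluster G v := by
  ext x
  exact ⟨fun hx ↦ SimpleGraph.Reachable.trans hu hx,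
    fun hx ↦ (SimpleGraph.Reachable.symm hu).trans hx⟩

/-- The first moment bound for the largest cluster. -/
theorem maxClusterSize_tail_mul_le (w : Fin n → ℝ) {x : ℝ} (hx : 0 ≤ x) :
    (graphLaw w).real {G | x < (maxClusterSize G : ℝ)} * x
      ≤ ∑ v, (edgeLaw (edgeProb w)).real {ξ | ⌊x⌋₊ < (explored ξ Finset.univ {v}).ncard} := by
  have hmap : (graphLaw w).real {G | x < (maxClusterSize G : ℝ)} = (edgeLaw (edgeProb w)).real
      {ξ | x < (maxClusterSize (SimpleGraph.fromEdgeSet {e | ξ e}) : ℝ)} := by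
    rw [graphLaw, map_measureReal_apply (fun s _ ↦ measurableSet_edgeConfig _)
      (SimpleGraph.measurableEmbedding_edgeSet.measurableSet_image.1
        (Set.toFinite _).measurableSet)]
    rfl
  set E : Fin n → Set (Sym2 (Fin n) → Prop) :=
    fun v ↦ {ξ | ⌊x⌋₊ < (explored ξ Finset.univ {v}).ncard}
  set f : (Sym2 (Fin n) → Prop) → ℝ := fun ξ ↦ ∑ v, (E v).indicator 1 ξ
  have hint (v : Fin n) : Integrable ((E v).indicator (1 : (Sym2 (Fin n) → Prop) → ℝ))
      (edgeLaw (edgeProb w)) :=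
    (integrable_const (1 : ℝ)).indicator (measurableSet_edgeConfig _)
  have hf : ∫ ξ, f ξ ∂edgeLaw (edgeProb w) = ∑ v, (edgeLaw (edgeProb w)).real (E v) := by
    rw [integral_finsetSum _ fun v _ ↦ hint v]
    exact Finset.sum_congr rfl fun v _ ↦ integral_indicator_one (measurableSet_edgeConfig _)
  rw [hmap, ← hf, mul_comm]
  refine le_trans (mul_le_mul_of_nonneg_left (measureReal_mono fun ξ hξ ↦ ?_) hx)
    (mul_meas_ge_le_integral_of_nonneg (Filter.Eventually.of_forall fun ξ ↦ ?_)
      (integrable_finsetSum _ fun v _ ↦ hint v) x)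
  · set G := SimpleGraph.fromEdgeSet {e | ξ e}
    obtain ⟨v, hv⟩ : ∃ v, x < ((cluster G v).ncard : ℝ) := by
      by_contra! h
      have : maxClusterSize G ≤ ⌊x⌋₊ := Finset.sup_le fun v _ ↦ Nat.le_floor (h v)
      exact absurd hξ (not_lt.2 ((Nat.cast_le.2 this).trans (Nat.floor_le hx)))
    have hfl : ⌊x⌋₊ < (cluster G v).ncard := (Nat.floor_lt hx).2 hv
    -- All vertices of a large cluster see that same cluster, so more than `x` of the indicators
    -- equal 1.
    have hmem (u : Fin n) (hu : u ∈ cluster G v) : ξ ∈ E u := by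
      refine lt_of_lt_of_le ?_ (Set.ncard_le_ncard (cluster_subset_explored ξ u) (Set.toFinite _))
      rwa [cluster_eq_of_mem hu]
    classical
    calc x ≤ ((cluster G v).ncard : ℝ) := hv.le
      _ = ∑ u ∈ (cluster G v).toFinset, 1 := by simp [Set.ncard_eq_toFinset_card']
      _ = ∑ u ∈ (cluster G v).toFinset, (E u).indicator 1 ξ :=
          Finset.sum_congr rfl fun u hu ↦ by
            rw [Set.indicator_of_mem (hmem u (Set.mem_toFinset.1 hu)), Pi.one_apply]
      _ ≤ f ξ := Finset.sum_le_univ_sum_of_nonneg fun u ↦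
          Set.indicator_nonneg (fun _ _ ↦ zero_le_one) _
  · exact Finset.sum_nonneg fun u _ ↦ Set.indicator_nonneg (fun _ _ ↦ zero_le_one) _

end LargestCluster
-- Elementary bounds for the exponential.
section ExpBounds

open Real

/-- Convexity of `exp`. It serves twice: to compare Bernoulli offspring with Poisson offspring, and
for the concavity argument in `deficit_le`. -/
lemma exp_neg_mul_le (a : ℝ) {x : ℝ} (hx0 : 0 ≤ x) (hx1 : x ≤ 1) :
    exp (-(a * x)) ≤ 1 - x + x * exp (-a) := by
  have h := convexOn_exp.2 (Set.mem_univ 0) (Set.mem_univ (-a)) (by linarith : 0 ≤ 1 - x) hx0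
    (by ring)
  simp only [smul_eq_mul, mul_zero, exp_zero, zero_add, mul_one] at h
  rwa [show -(a * x) = x * -a by ring]

lemma exp_neg_le_quadratic {t : ℝ} (ht : 0 ≤ t) : exp (-t) ≤ 1 - t + t ^ 2 / 2 := by
  have h := quadratic_le_exp_of_nonneg ht
  rw [exp_neg, inv_le_iff_one_le_mul₀ (exp_pos t)]
  have h1 : 0 ≤ 1 - t + t ^ 2 / 2 := by nlinarith [sq_nonneg (t - 1)]
  nlinarith [mul_le_mul_of_nonneg_left h h1, sq_nonneg (t ^ 2)]

lemma cubic_le_exp_neg {t : ℝ} (ht : 0 ≤ t) : 1 - t + t ^ 2 / 2 - t ^ 3 / 6 ≤ exp (-t) := by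
  have hd (x : ℝ) : HasDerivAt (fun t ↦ exp (-t) - (1 - t + t ^ 2 / 2 - t ^ 3 / 6))
      (-exp (-x) - (-1 + x - x ^ 2 / 2)) x := by
    have h1 := ((hasDerivAt_id x).neg).exp
    have h2 := (((hasDerivAt_const x (1 : ℝ)).sub (hasDerivAt_id x)).add
      ((hasDerivAt_pow 2 x).div_const 2)).sub ((hasDerivAt_pow 3 x).div_const 6)
    refine (h1.sub h2).congr_deriv ?_
    simp
    ring
  have hmono : MonotoneOn (fun t ↦ exp (-t) - (1 - t + t ^ 2 / 2 - t ^ 3 / 6)) (Set.Ici 0) := by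
    refine monotoneOn_of_deriv_nonneg (convex_Ici 0)
      (fun x _ ↦ (hd x).continuousAt.continuousWithinAt)
      (fun x _ ↦ (hd x).differentiableAt.differentiableWithinAt) fun x hx ↦ ?_
    rw [interior_Ici, Set.mem_Ioi] at hx
    rw [(hd x).deriv]
    linarith [exp_neg_le_quadratic hx.le]
  have := hmono Set.self_mem_Ici ht ht
  simp at this
  linarith

end ExpBounds

/-! ### Numerical estimates near criticality. -/

section Arithmetic

/-- At `y = c a` the main term is `c ^ 2 / 2` times `q a ^ 2`. The margin 0.009 covers 0.0031 from
the drift `ν - 1` and 0.005 from the cubic term. -/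
lemma near_critical_upper {q ν s a W c r : ℝ} (hc0 : 0 < c) (hc : c ≤ 3) (ha : 0 < a)
    (hs : 0 < s) (hq : 0 < q) (hWa : W * a ≤ 0.0011)
    (hsa : s * a ≤ 1.001 * (q * a ^ 2)) (hν : ν - 1 ≤ s / 1000) (hr : r + 0.009 ≤ c ^ 2 / 2) :
    r * (q * a ^ 2) < (1 - ν) * (c * a) + q * ((c * a) ^ 2 / 2 - W * (c * a) ^ 3 / 6) := by
  have hqa0 : 0 < q * a ^ 2 := by positivity
  have h1 : (ν - 1) * (c * a) ≤ 0.0031 * (q * a ^ 2) := by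
    have : (ν - 1) * (c * a) ≤ s / 1000 * (c * a) :=
      mul_le_mul_of_nonneg_right hν (by positivity)
    have : s / 1000 * (c * a) ≤ s / 1000 * (3 * a) := by gcongr
    linarith
  have h2 : W * (c * a) ^ 3 / 6 ≤ 0.005 * a ^ 2 := by
    have hc3 : c ^ 3 ≤ 27 := by
      calc c ^ 3 ≤ 3 ^ 3 := pow_le_pow_left₀ hc0.le hc 3
        _ = 27 := by norm_num
    have h : W * a * c ^ 3 ≤ 0.0011 * 27 := mul_le_mul hWa hc3 (by positivity) (by norm_num)
    calc W * (c * a) ^ 3 / 6 = W * a * c ^ 3 / 6 * a ^ 2 := by ring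
      _ ≤ 0.005 * a ^ 2 := mul_le_mul_of_nonneg_right (by linarith) (sq_nonneg a)
  have h3 : q * (W * (c * a) ^ 3 / 6) ≤ 0.005 * (q * a ^ 2) := by
    have := mul_le_mul_of_nonneg_left h2 hq.le
    linarith
  have h4 : (r + 0.009) * (q * a ^ 2) ≤ c ^ 2 / 2 * (q * a ^ 2) :=
    mul_le_mul_of_nonneg_right hr hqa0.le
  have h5 : q * ((c * a) ^ 2 / 2 - W * (c * a) ^ 3 / 6)
      = c ^ 2 / 2 * (q * a ^ 2) - q * (W * (c * a) ^ 3 / 6) := by ring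
  rw [h5]
  linarith

/-- To leading order the inequality reads `4 q a ^ 2 ≤ q y ^ 2 / 2`, whence `y ≥ √8 a`; 2.82 is just
below `√8`. -/
lemma near_critical_lower {q ν s a ε y : ℝ} (ha : 0 < a) (hs : 0 < s) (hs1 : s ≤ 1 / 1000)
    (hq : 0 < q) (has : a ≤ 1.001 * s) (hqa : q * a ^ 2 = s ^ 2)
    (hsa : s * a ≤ 1.001 * (q * a ^ 2)) (hν1 : 1 - s / 1000 ≤ ν) (hν2 : ν ≤ 1 + s / 1000)
    (hε : ε ≤ s / 1000) (hy0 : 0 ≤ y) (hy : y ≤ 3 * a)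
    (h : 4 * (q * a ^ 2) + (1 - ε) * (ν * y)
      - ((4 * (q * a ^ 2)) ^ 2 / 2 + 4 * (q * a ^ 2) * (ν * y) + q * (y ^ 2 / 2)) ≤ y) :
    2.82 * a ≤ y := by
  set t := q * a ^ 2 with ht
  have ht0 : 0 < t := by positivity
  have hν0 : 0 ≤ ν := by linarith
  have ht1 : t ≤ 0.000001 := by rw [hqa]; nlinarith
  have h1 : (4 * t) ^ 2 / 2 ≤ 0.00001 * t := by nlinarith
  have h2 : ν * y ≤ 0.0031 := by
    have : ν * y ≤ 1.01 * (3 * a) := mul_le_mul (by linarith) hy hy0 (by norm_num)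
    linarith
  have h3 : 4 * t * (ν * y) ≤ 0.0124 * t := by
    have := mul_le_mul_of_nonneg_left h2 ht0.le
    linarith
  have h4 : y - (1 - ε) * (ν * y) ≤ 0.0064 * t := by
    have h5 : 1 - ν + ε * ν ≤ 0.0021 * s := by
      have : ε * ν ≤ s / 1000 * 1.01 := mul_le_mul hε (by linarith) hν0 (by positivity)
      linarith
    calc y - (1 - ε) * (ν * y) = (1 - ν + ε * ν) * y := by ring
      _ ≤ 0.0021 * s * y := mul_le_mul_of_nonneg_right h5 hy0
      _ ≤ 0.0021 * s * (3 * a) := mul_le_mul_of_nonneg_left hy (by positivity)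
      _ ≤ 0.0064 * t := by linarith
  have h6 : q * (7.96 * a ^ 2) ≤ q * y ^ 2 := by
    have : q * (7.96 * a ^ 2) = 7.96 * t := by rw [ht]; ring
    linarith
  have h7 := le_of_mul_le_mul_left h6 hq
  refine (pow_le_pow_iff_left₀ (by positivity) hy0 two_ne_zero).1 ?_
  nlinarith [sq_nonneg a]

/-- The main term is `2 * 2.01 - 2.82 = 1.2`; the rest is of lower order in `s`. -/
lemma near_critical_sum {l N ν s a ε y y' : ℝ} (hl : 0 ≤ l) (hlN : l ≤ N) (hs : 0 < s)
    (hs1 : s ≤ 1 / 1000) (ha : 0 < a) (has : a ≤ 1.001 * s)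
    (hν2 : ν ≤ 1 + s / 1000) (hε : ε ≤ s / 1000) (hy : y ≤ 2.01 * a)
    (hlow : 2.82 * a ≤ y') (hy' : y' ≤ 3 * a) :
    l * (2 * y - (1 - ε) * y') + 8 * s ^ 4 * N + 4 * s ^ 2 * l * y' + ν * l * y' ^ 2 / 2
      ≤ 1.22 * s * N := by
  have hy'0 : 0 ≤ y' := by linarith
  have hε1 : ε * y' ≤ 0.001 * s := by
    have : ε * y' ≤ s / 1000 * (3 * a) := mul_le_mul hε hy' hy'0 (by positivity)
    nlinarith
  have h2 : s ^ 2 ≤ 0.001 * s := by nlinarith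
  have h1 : 4 * s ^ 2 * y' ≤ 0.001 * s := by
    have : 4 * s ^ 2 * y' ≤ 4 * (0.001 * s) * (3 * a) :=
      mul_le_mul (by linarith) hy' hy'0 (by positivity)
    nlinarith
  have h3 : 8 * s ^ 4 ≤ 0.001 * s := by
    have : s ^ 4 = s ^ 2 * s ^ 2 := by ring
    nlinarith [mul_le_mul h2 h2 (sq_nonneg s) (by positivity : 0 ≤ 0.001 * s)]
  have h4 : ν * y' ^ 2 / 2 ≤ 0.0047 * s := by
    have h5 : y' ^ 2 ≤ (3 * a) ^ 2 := pow_le_pow_left₀ hy'0 hy' 2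
    have h6 : (3 * a) ^ 2 ≤ (3 * (1.001 * s)) ^ 2 := by
      apply pow_le_pow_left₀ <;> linarith
    have h7 : ν * y' ^ 2 ≤ 1.01 * (3 * (1.001 * s)) ^ 2 :=
      mul_le_mul (by linarith) (h5.trans h6) (sq_nonneg _) (by norm_num)
    nlinarith
  have hN : 0 ≤ N := hl.trans hlN
  calc _ = l * (2 * y - y' + ε * y' + 4 * s ^ 2 * y' + ν * y' ^ 2 / 2) + 8 * s ^ 4 * N := by ring
    _ ≤ l * (1.21 * s) + 0.001 * s * N := by
        refine add_le_add (mul_le_mul_of_nonneg_left ?_ hl) (mul_le_mul_of_nonneg_right h3 hN)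
        linarith
    _ ≤ N * (1.21 * s) + 0.001 * s * N := by gcongr
    _ ≤ 1.22 * s * N := by nlinarith [mul_nonneg hs.le hN]

end Arithmetic

/-! ### Two-sided bounds for the size-biased deficit. -/

section Deficit

open Real

variable {V : Type*} [Fintype V]

/-- The weighted average of the probabilities `1 - progeny p z u`. -/
noncomputable def deficit (p : Sym2 V → unitInterval) (w : V → ℝ) (z : ℝ) : ℝ :=
  ∑ u, w u / (∑ v, w v) * (1 - progeny p z u)

variable {p : Sym2 V → unitInterval} {w : V → ℝ}

lemma deficit_nonneg (hw : ∀ v, 0 ≤ w v) {z : ℝ} (hz0 : 0 ≤ z) (hz1 : z ≤ 1) :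
    0 ≤ deficit p w z :=
  Finset.sum_nonneg fun u _ ↦ mul_nonneg (div_nonneg (hw u) (Finset.sum_nonneg fun v _ ↦ hw v))
    (by linarith [(progeny_mem p hz0 hz1 u).2])

lemma one_sub_progeny_le (hp : ∀ u v, (p s(u, v) : ℝ) = 1 - exp (-(w u * w v / ∑ v, w v)))
    {z : ℝ} (hz0 : 0 ≤ z) (hz1 : z ≤ 1) (v : V) :
    1 - progeny p z v ≤ 1 - z + (1 - exp (-(w v * deficit p w z))) := by
  have hprod : exp (-(w v * deficit p w z))
      ≤ ∏ u, (1 - p s(v, u) + p s(v, u) * progeny p z u : ℝ) := by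
    rw [deficit, Finset.mul_sum, ← Finset.sum_neg_distrib, exp_sum]
    refine Finset.prod_le_prod (fun u _ ↦ (exp_pos _).le) fun u _ ↦ ?_
    have hg := progeny_mem p hz0 hz1 u
    have h := exp_neg_mul_le (w v * w u / ∑ v, w v) (x := 1 - progeny p z u)
      (by linarith [hg.2]) (by linarith [hg.1])
    rw [hp]
    rw [show w v * (w u / (∑ v, w v) * (1 - progeny p z u))
      = w v * w u / (∑ v, w v) * (1 - progeny p z u) by ring]
    linarith
  have h1 := mul_le_mul_of_nonneg_left hprod hz0
  rw [← progeny_eq p hz0 hz1] at h1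
  have hd : exp (-(w v * deficit p w z)) ≤ 1 := by
    refine hprod.trans (Finset.prod_le_one (fun u _ ↦ ?_) fun u _ ↦ ?_)
    · nlinarith [(p s(v, u)).2.1, (p s(v, u)).2.2, (progeny_mem p hz0 hz1 u).1]
    · nlinarith [(p s(v, u)).2.1, (progeny_mem p hz0 hz1 u).2]
  nlinarith

/-- The reverse of the Poisson comparison costs a factor `1 - ε`: for `a ≤ 2ε`, `1 - exp (-a) ≥ a -
a ^ 2 / 2 ≥ (1 - ε) a`. -/
lemma le_one_sub_progeny (hw : ∀ v, 0 ≤ w v)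
    (hp : ∀ u v, (p s(u, v) : ℝ) = 1 - exp (-(w u * w v / ∑ v, w v)))
    {ε : ℝ} (hε : ε ≤ 1) (hwε : ∀ u v, w u * w v / ∑ v, w v ≤ 2 * ε) {h : ℝ} (hh : 0 ≤ h)
    (v : V) :
    h + (1 - ε) * (w v * deficit p w (exp (-h)))
      - (h + w v * deficit p w (exp (-h))) ^ 2 / 2 ≤ 1 - progeny p (exp (-h)) v := by
  have hz0 : 0 ≤ exp (-h) := (exp_pos _).le
  have hz1 : exp (-h) ≤ 1 := exp_le_one_iff.2 (by linarith)
  set y := deficit p w (exp (-h))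
  have hy : 0 ≤ y := deficit_nonneg hw hz0 hz1
  have hsum : 0 ≤ ∑ v, w v := Finset.sum_nonneg fun v _ ↦ hw v
  have hε0 : 0 ≤ ε := by
    have h1 : 0 ≤ w v * w v / ∑ v, w v := div_nonneg (mul_nonneg (hw v) (hw v)) hsum
    linarith [hwε v v]
  have hprod : ∏ u, (1 - p s(v, u) + p s(v, u) * progeny p (exp (-h)) u : ℝ)
      ≤ exp (-((1 - ε) * (w v * y))) := by
    simp only [y]
    rw [deficit, Finset.mul_sum, Finset.mul_sum, ← Finset.sum_neg_distrib, exp_sum]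
    refine Finset.prod_le_prod (fun u _ ↦ ?_) fun u _ ↦ ?_
    · nlinarith [(p s(v, u)).2.1, (p s(v, u)).2.2, (progeny_mem p hz0 hz1 u).1]
    have hg := progeny_mem p hz0 hz1 u
    set x := 1 - progeny p (exp (-h)) u with hx
    set a := w v * w u / ∑ v, w v with ha
    have ha0 : 0 ≤ a := div_nonneg (mul_nonneg (hw v) (hw u)) hsum
    have hx0 : 0 ≤ x := by linarith [hg.2]
    have h1 : (1 - ε) * a ≤ p s(v, u) := by
      rw [hp]
      have := exp_neg_le_quadratic ha0
      nlinarith [hwε v u]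
    have h2 := add_one_le_exp (-((1 - ε) * (a * x)))
    rw [show w v * (w u / (∑ v, w v) * x) = a * x by rw [ha]; ring]
    nlinarith [mul_le_mul_of_nonneg_right h1 hx0]
  have h1 := mul_le_mul_of_nonneg_left hprod hz0
  rw [← progeny_eq p hz0 hz1, ← exp_add, ← neg_add] at h1
  have hwy : 0 ≤ w v * y := mul_nonneg (hw v) hy
  have ht : 0 ≤ h + (1 - ε) * (w v * y) := by nlinarith
  have h2 := exp_neg_le_quadratic ht
  have h3 : (h + (1 - ε) * (w v * y)) ^ 2 ≤ (h + w v * y) ^ 2 :=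
    pow_le_pow_left₀ ht (by nlinarith) 2
  linarith

/-- A self-bounding inequality for the deficit. -/
lemma deficit_le_sum (hw : ∀ v, 0 ≤ w v) (hl : 0 < ∑ v, w v)
    (hp : ∀ u v, (p s(u, v) : ℝ) = 1 - exp (-(w u * w v / ∑ v, w v)))
    {z : ℝ} (hz0 : 0 ≤ z) (hz1 : z ≤ 1) :
    deficit p w z ≤ 1 - z
      + ∑ u, w u / (∑ v, w v) * (1 - exp (-(w u * deficit p w z))) := by
  have h1 : ∑ u, w u / (∑ v, w v) = 1 := by rw [← Finset.sum_div, div_self hl.ne']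
  calc deficit p w z ≤ ∑ u, w u / (∑ v, w v) * (1 - z + (1 - exp (-(w u * deficit p w z)))) :=
        Finset.sum_le_sum fun u _ ↦ mul_le_mul_of_nonneg_left (one_sub_progeny_le hp hz0 hz1 u)
          (div_nonneg (hw u) hl.le)
    _ = _ := by simp_rw [mul_add, Finset.sum_add_distrib, ← Finset.sum_mul, h1, one_mul]

lemma sum_weight_mul_one_sub_exp_le (hw : ∀ v, 0 ≤ w v) (hl : 0 < ∑ v, w v) {W : ℝ}
    (hW : ∀ v, w v ≤ W) {y : ℝ} (hy : 0 ≤ y) :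
    ∑ u, w u / (∑ v, w v) * (1 - exp (-(w u * y)))
      ≤ (∑ u, w u ^ 2) / (∑ v, w v) * y - (∑ u, w u ^ 3) / (∑ v, w v) * (y ^ 2 / 2)
        + (∑ u, w u ^ 3) / (∑ v, w v) * (W * y ^ 3 / 6) := by
  simp_rw [Finset.sum_div, Finset.sum_mul]
  rw [← Finset.sum_sub_distrib, ← Finset.sum_add_distrib]
  refine Finset.sum_le_sum fun u _ ↦ ?_
  have h := cubic_le_exp_neg (mul_nonneg (hw u) hy)
  have hc : 0 ≤ w u / ∑ v, w v := div_nonneg (hw u) hl.le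
  have h2 : (w u * y) ^ 3 ≤ w u ^ 2 * W * y ^ 3 := by
    rw [mul_pow]
    refine mul_le_mul_of_nonneg_right ?_ (pow_nonneg hy 3)
    rw [pow_succ]
    exact mul_le_mul_of_nonneg_left (hW u) (sq_nonneg _)
  calc _ ≤ w u / (∑ v, w v) * (w u * y - (w u * y) ^ 2 / 2 + w u ^ 2 * W * y ^ 3 / 6) :=
        mul_le_mul_of_nonneg_left (by linarith) hc
    _ = _ := by ring

/-- An upper bound for the deficit. -/
lemma deficit_le (hw : ∀ v, 0 ≤ w v) (hl : 0 < ∑ v, w v)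
    (hp : ∀ u v, (p s(u, v) : ℝ) = 1 - exp (-(w u * w v / ∑ v, w v)))
    {W : ℝ} (hW : ∀ v, w v ≤ W) {h : ℝ} (hh : 0 ≤ h) {y : ℝ} (hy : 0 < y)
    (hlt : h < (1 - (∑ u, w u ^ 2) / ∑ v, w v) * y
      + (∑ u, w u ^ 3) / (∑ v, w v) * (y ^ 2 / 2 - W * y ^ 3 / 6)) :
    deficit p w (exp (-h)) ≤ y := by
  by_contra! hcon
  have hz1 : exp (-h) ≤ 1 := exp_le_one_iff.2 (by linarith)
  have h1 := deficit_le_sum hw hl hp (exp_pos (-h)).le hz1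
  set Y := deficit p w (exp (-h))
  have hY : 0 < Y := hy.trans hcon
  have hyY : y / Y ≤ 1 := (div_le_one hY).2 hcon.le
  have hyY0 : 0 ≤ y / Y := by positivity
  -- The sum is concave in its argument and vanishes at 0. Scaling the self-bounding inequality from
  -- `Y` down to `y` contradicts `hlt`, with no prior smallness of `Y`.
  have h2 : y / Y * ∑ u, w u / (∑ v, w v) * (1 - exp (-(w u * Y)))
      ≤ ∑ u, w u / (∑ v, w v) * (1 - exp (-(w u * y))) := by
    rw [Finset.mul_sum]
    refine Finset.sum_le_sum fun u _ ↦ ?_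
    rw [mul_left_comm]
    refine mul_le_mul_of_nonneg_left ?_ (div_nonneg (hw u) hl.le)
    have := exp_neg_mul_le (w u * Y) hyY0 hyY
    rw [show w u * Y * (y / Y) = w u * y by field_simp] at this
    linarith
  have h3 := mul_le_mul_of_nonneg_left h1 hyY0
  rw [mul_add, div_mul_cancel₀ _ hY.ne'] at h3
  have h4 : y / Y * (1 - exp (-h)) ≤ h := by
    have := add_one_le_exp (-h)
    nlinarith
  linarith [sum_weight_mul_one_sub_exp_le hw hl hW hy.le]

/-- A lower bound for the deficit. -/
lemma le_deficit (hw : ∀ v, 0 ≤ w v) (hl : 0 < ∑ v, w v)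
    (hp : ∀ u v, (p s(u, v) : ℝ) = 1 - exp (-(w u * w v / ∑ v, w v)))
    {ε : ℝ} (hε : ε ≤ 1) (hwε : ∀ u v, w u * w v / ∑ v, w v ≤ 2 * ε) {h : ℝ} (hh : 0 ≤ h)
    {y : ℝ} (hy : y = deficit p w (exp (-h))) :
    h + (1 - ε) * ((∑ u, w u ^ 2) / (∑ v, w v) * y)
      - (h ^ 2 / 2 + h * ((∑ u, w u ^ 2) / (∑ v, w v) * y)
        + (∑ u, w u ^ 3) / (∑ v, w v) * (y ^ 2 / 2)) ≤ y := by
  have h1 : ∑ u, w u / (∑ v, w v) = 1 := by rw [← Finset.sum_div, div_self hl.ne']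
  calc _ = ∑ u, w u / (∑ v, w v) * (h + (1 - ε) * (w u * y) - (h + w u * y) ^ 2 / 2) := by
        rw [show h + (1 - ε) * ((∑ u, w u ^ 2) / (∑ v, w v) * y)
            - (h ^ 2 / 2 + h * ((∑ u, w u ^ 2) / (∑ v, w v) * y)
              + (∑ u, w u ^ 3) / (∑ v, w v) * (y ^ 2 / 2))
          = (∑ u, w u / (∑ v, w v)) * (h - h ^ 2 / 2)
            + (∑ u, w u ^ 2 / (∑ v, w v)) * ((1 - ε) * y - h * y)
            - (∑ u, w u ^ 3 / (∑ v, w v)) * (y ^ 2 / 2) by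
          rw [h1, Finset.sum_div, Finset.sum_div]; ring]
        simp_rw [Finset.sum_mul]
        rw [← Finset.sum_add_distrib, ← Finset.sum_sub_distrib]
        exact Finset.sum_congr rfl fun u _ ↦ by ring
    _ ≤ deficit p w (exp (-h)) := by
        rw [hy]
        exact Finset.sum_le_sum fun u _ ↦ mul_le_mul_of_nonneg_left
          (le_one_sub_progeny hw hp hε hwε hh u) (div_nonneg (hw u) hl.le)
    _ = y := hy.symm

lemma sum_progeny_le_deficit (hw : ∀ v, 0 ≤ w v) (hl : 0 < ∑ v, w v)
    (hp : ∀ u v, (p s(u, v) : ℝ) = 1 - exp (-(w u * w v / ∑ v, w v)))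
    {ε : ℝ} (hε : ε ≤ 1) (hwε : ∀ u v, w u * w v / ∑ v, w v ≤ 2 * ε) {t : ℝ} (ht : 0 ≤ t)
    {y y' : ℝ} (hy : y = deficit p w (exp (-(2 * t)))) (hy' : y' = deficit p w (exp (-(4 * t)))) :
    ∑ v, (1 - 2 * progeny p (exp (-(2 * t))) v + progeny p (exp (-(4 * t))) v)
      ≤ (∑ v, w v) * (2 * y - (1 - ε) * y') + 8 * t ^ 2 * Fintype.card V
        + 4 * t * (∑ v, w v) * y' + (∑ v, w v ^ 2) / (∑ v, w v) * (∑ v, w v) * y' ^ 2 / 2 := by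
  calc _ ≤ ∑ v, (w v * (2 * y - (1 - ε) * y') + 8 * t ^ 2 + w v * (4 * t * y')
        + w v ^ 2 * (y' ^ 2 / 2)) := by
        refine Finset.sum_le_sum fun v _ ↦ ?_
        have h1 := one_sub_progeny_le hp (exp_pos (-(2 * t))).le
          (exp_le_one_iff.2 (by linarith)) v
        have h2 := le_one_sub_progeny hw hp hε hwε (by positivity : 0 ≤ 4 * t) v
        rw [← hy] at h1
        rw [← hy'] at h2
        have h3 := add_one_le_exp (-(w v * y))
        have h4 := add_one_le_exp (-(2 * t))
        linarith
    _ = _ := by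
        rw [div_mul_cancel₀ _ hl.ne']
        simp_rw [Finset.sum_add_distrib, ← Finset.sum_mul]
        rw [Finset.sum_const, Finset.card_univ, nsmul_eq_mul]
        ring

/-- In the critical window the second order quantity that controls the cluster tail is of the
order of the square root of the killing rate, with an explicit constant. -/
theorem sum_progeny_le (hw : ∀ v, 0 ≤ w v) (hl : 0 < ∑ v, w v)
    (hp : ∀ u v, (p s(u, v) : ℝ) = 1 - exp (-(w u * w v / ∑ v, w v)))
    {W s : ℝ} (hW : ∀ v, w v ≤ W) (hs : 0 < s) (hs1 : s ≤ 1 / 1000) (hWs : W * s ≤ 1 / 1000)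
    (hWl : W ^ 2 / ∑ v, w v ≤ s / 500) (hln : ∑ v, w v ≤ Fintype.card V)
    (hν : |(∑ u, w u ^ 2) / (∑ v, w v) - 1| ≤ s / 1000) :
    ∑ v, (1 - 2 * progeny p (exp (-(2 * s ^ 2))) v + progeny p (exp (-(2 * s ^ 2)) ^ 2) v)
      ≤ 1.22 * s * Fintype.card V := by
  have hW0 : 0 ≤ W := by
    obtain ⟨v, -, hv⟩ := Finset.exists_ne_zero_of_sum_ne_zero hl.ne'
    exact (hw v).trans (hW v)
  have hexp2 : exp (-(2 * s ^ 2)) ^ 2 = exp (-(4 * s ^ 2)) := by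
    rw [← exp_nat_mul]; congr 1; push_cast; ring
  rw [hexp2]
  obtain ⟨l, hl_def⟩ : ∃ l, l = ∑ v, w v := ⟨_, rfl⟩
  obtain ⟨ν, hν_def⟩ : ∃ ν, ν = (∑ u, w u ^ 2) / ∑ v, w v := ⟨_, rfl⟩
  obtain ⟨q, hq_def⟩ : ∃ q, q = (∑ u, w u ^ 3) / ∑ v, w v := ⟨_, rfl⟩
  obtain ⟨ε, hε_def⟩ : ∃ ε, ε = W ^ 2 / (∑ v, w v) / 2 := ⟨_, rfl⟩
  -- The difference is the variance of the weight under its size-biased law.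
  have hq : ν ^ 2 ≤ q := by
    have h := Finset.sum_nonneg fun u (_ : u ∈ Finset.univ) ↦
      mul_nonneg (div_nonneg (hw u) hl.le) (sq_nonneg (w u - ν))
    have h2 : ∑ u, w u / (∑ v, w v) * (w u - ν) ^ 2 = q - ν ^ 2 := by
      have h1 : ∑ u, w u / (∑ v, w v) = 1 := by rw [← Finset.sum_div, div_self hl.ne']
      calc _ = ∑ u, (w u ^ 3 / (∑ v, w v) - 2 * ν * (w u ^ 2 / (∑ v, w v))
              + ν ^ 2 * (w u / (∑ v, w v))) :=
            Finset.sum_congr rfl fun u _ ↦ by ring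
        _ = q - 2 * ν * ν + ν ^ 2 * 1 := by
            rw [Finset.sum_add_distrib, Finset.sum_sub_distrib, ← Finset.mul_sum,
              ← Finset.mul_sum, h1, ← Finset.sum_div, ← Finset.sum_div, ← hq_def, ← hν_def]
        _ = _ := by ring
    linarith
  rw [← hν_def] at hν
  obtain ⟨hν1, hν2⟩ := abs_le.1 hν
  have hq0 : 0.99999 ≤ q := by nlinarith
  have hσq : √q ^ 2 = q := sq_sqrt (by linarith)
  have hσ : 0.9999 ≤ √q := le_sqrt_of_sq_le (by linarith)
  have hσq' : √q ≤ 1.001 * q := by nlinarith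
  obtain ⟨a, ha_def⟩ : ∃ a, a = s / √q := ⟨_, rfl⟩
  have hσa : √q * a = s := by rw [ha_def]; field_simp
  have ha : 0 < a := by rw [ha_def]; positivity
  have has : a ≤ 1.001 * s := by nlinarith
  have hqa : q * a ^ 2 = s ^ 2 := by rw [← hσa, mul_pow, hσq]
  have hsa : s * a ≤ 1.001 * (q * a ^ 2) := by
    calc s * a = √q * a ^ 2 := by rw [← hσa]; ring
      _ ≤ 1.001 * q * a ^ 2 := mul_le_mul_of_nonneg_right hσq' (sq_nonneg a)
      _ = _ := by ring
  have hWa : W * a ≤ 0.0011 := by nlinarith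
  have hε0 : 0 ≤ ε := by rw [hε_def]; positivity
  have hεs : ε ≤ s / 1000 := by rw [hε_def]; linarith
  have hwε (u v : V) : w u * w v / ∑ v, w v ≤ 2 * ε := by
    rw [hε_def, mul_div_cancel₀ _ two_ne_zero, sq]
    exact div_le_div_of_nonneg_right (mul_le_mul (hW u) (hW v) (hw v) hW0) hl.le
  have hup (c r : ℝ) (hc0 : 0 < c) (hc : c ≤ 3) (hr0 : 0 ≤ r) (hr : r + 0.009 ≤ c ^ 2 / 2) :
      deficit p w (exp (-(r * s ^ 2))) ≤ c * a := by
    refine deficit_le hw hl hp hW (by positivity) (by positivity) ?_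
    rw [← hν_def, ← hq_def, ← hqa]
    exact near_critical_upper hc0 hc ha hs (by linarith) hWa hsa hν2 hr
  obtain ⟨y, hy_def⟩ : ∃ y, y = deficit p w (exp (-(2 * s ^ 2))) := ⟨_, rfl⟩
  obtain ⟨y', hy'_def⟩ : ∃ y, y = deficit p w (exp (-(4 * s ^ 2))) := ⟨_, rfl⟩
  have hy : y ≤ 2.01 * a :=
    hy_def ▸ hup 2.01 2 (by norm_num) (by norm_num) (by norm_num) (by norm_num)
  have hy' : y' ≤ 3 * a :=
    hy'_def ▸ hup 3 4 (by norm_num) (by norm_num) (by norm_num) (by norm_num)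
  have hy'0 : 0 ≤ y' :=
    hy'_def ▸ deficit_nonneg hw (exp_pos _).le (exp_le_one_iff.2 (by nlinarith))
  have hlow : 2.82 * a ≤ y' := by
    have h := le_deficit hw hl hp (by linarith) hwε (by positivity : 0 ≤ 4 * s ^ 2) hy'_def
    rw [← hν_def, ← hq_def, ← hqa] at h
    exact near_critical_lower ha hs hs1 (by linarith) has hqa hsa (by linarith) (by linarith)
      hεs hy'0 hy' h
  refine (sum_progeny_le_deficit hw hl hp (by linarith) hwε (sq_nonneg s) hy_def hy'_def).trans ?_
  rw [← hν_def, ← hl_def, show 8 * (s ^ 2) ^ 2 = 8 * s ^ 4 by ring]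
  rw [← hl_def] at hl hln
  exact near_critical_sum hl.le hln hs hs1 ha has (by linarith) hεs hy hlow hy'

end Deficit
-- Quantile weights and their level counts.
section Quantile

open Filter Topology

variable (μ : Measure ℝ) [IsProbabilityMeasure μ]

lemma one_sub_cdf_eq (t : ℝ) : 1 - cdf μ t = μ.real (Set.Ioi t) := by
  rw [cdf_eq_real, ← Set.compl_Iic, probReal_compl_eq_one_sub measurableSet_Iic]

/-- The Galois connection between the generalized inverse and the tail. -/
lemma lt_tailInverse_iff {u : ℝ} (hu0 : 0 < u) (hu1 : u < 1) (t : ℝ) :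
    t < tailInverse (cdf μ) u ↔ u < μ.real (Set.Ioi t) := by
  rw [tailInverse, if_neg hu1.ne, ← one_sub_cdf_eq]
  have hne : {s : ℝ | 1 - cdf μ s ≤ u}.Nonempty := by
    obtain ⟨s, hs⟩ := ((tendsto_cdf_atTop μ).eventually_const_lt (by linarith : 1 - u < 1)).exists
    exact ⟨s, by simp only [Set.mem_ofPred_eq]; linarith⟩
  constructor
  · intro h
    by_contra! hcon
    have hbdd : BddBelow {s : ℝ | 1 - cdf μ s ≤ u} := by
      obtain ⟨b, hb⟩ := ((tendsto_cdf_atBot μ).eventually_lt_const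
        (by linarith : 0 < 1 - u)).exists
      refine ⟨b, fun s hs ↦ ?_⟩
      simp only [Set.mem_ofPred_eq] at hs
      by_contra! hsb
      linarith [monotone_cdf μ hsb.le]
    exact absurd h (not_lt.2 (csInf_le hbdd hcon))
  · intro h
    have hcont := ((cdf μ).right_continuous t).mono_left (nhdsWithin_mono t Set.Ioi_subset_Ici_self)
    obtain ⟨t', ht', htt'⟩ := ((hcont.eventually_lt_const (by linarith : cdf μ t < 1 - u)).and
      self_mem_nhdsWithin).exists
    refine lt_of_lt_of_le (Set.mem_Ioi.1 htt') (le_csInf hne fun s hs ↦ ?_)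
    simp only [Set.mem_ofPred_eq] at hs
    by_contra! hst
    linarith [monotone_cdf μ hst.le]

/-- For the last vertex the convention that the inverse at 1 is 0 makes both sides false; this uses
`0 ≤ t`. -/
lemma lt_weight_iff {n : ℕ} (i : Fin n) {t : ℝ} (ht : 0 ≤ t) :
    t < weight (cdf μ) n i ↔ (i : ℝ) + 1 < n * μ.real (Set.Ioi t) := by
  have hn : (0 : ℝ) < n := by exact_mod_cast i.pos
  have hi : (i : ℝ) + 1 ≤ n := by exact_mod_cast i.isLt
  rw [weight]
  obtain hi | hi := hi.eq_or_lt
  · rw [hi, div_self hn.ne', tailInverse, if_pos rfl]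
    have : (n : ℝ) * μ.real (Set.Ioi t) ≤ n := mul_le_of_le_one_right hn.le measureReal_le_one
    exact ⟨fun h ↦ absurd h (not_lt.2 ht), fun h ↦ absurd h (not_lt.2 this)⟩
  · rw [lt_tailInverse_iff μ (by positivity) ((div_lt_one hn).2 hi), div_lt_iff₀' hn]

lemma weight_nonneg (hpos : μ (Set.Iic 0) = 0) {n : ℕ} (i : Fin n) :
    0 ≤ weight (cdf μ) n i := by
  have hn : (0 : ℝ) < n := by exact_mod_cast i.pos
  have hi : (i : ℝ) + 1 ≤ n := by exact_mod_cast i.isLt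
  obtain hi | hi := hi.eq_or_lt
  · rw [weight, hi, div_self hn.ne', tailInverse, if_pos rfl]
  · refine ((lt_weight_iff μ i le_rfl).2 ?_).le
    have : μ.real (Set.Ioi 0) = 1 := by
      rw [← one_sub_cdf_eq, cdf_eq_real, measureReal_def, hpos]; simp
    rwa [this, mul_one]

/-- With `x = n * P(W > t)`, the indices with `i + 1 < x` number `⌈x⌉₊ - 1`, which is below `x` by
at most 1. -/
lemma count_lt_weight {n : ℕ} {t : ℝ} (ht : 0 ≤ t) :
    Measure.count {i | t < weight (cdf μ) n i} ≤ n * μ (Set.Ioi t) ∧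
      n * μ (Set.Ioi t) ≤ Measure.count {i | t < weight (cdf μ) n i} + 1 := by
  classical
  set x : ℝ := n * μ.real (Set.Ioi t) with hx
  have hx0 : 0 ≤ x := by positivity
  have hxn : x ≤ n := mul_le_of_le_one_right (Nat.cast_nonneg n) measureReal_le_one
  have hset : {i | t < weight (cdf μ) n i}
      = ((Finset.univ.filter fun i : Fin n ↦ (i : ℕ) < ⌈x⌉₊ - 1 : Finset (Fin n)) :
        Set (Fin n)) := by
    ext i
    simp only [Set.mem_ofPred_eq, Finset.coe_filter, Finset.mem_univ, true_and,
      lt_weight_iff μ i ht]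
    rw [← hx, ← Nat.cast_add_one, ← Nat.lt_ceil]
    omega
  have hceil : ⌈x⌉₊ ≤ n := Nat.ceil_le.2 hxn
  have hcard : Measure.count {i | t < weight (cdf μ) n i} = ENNReal.ofReal (⌈x⌉₊ - 1 : ℕ) := by
    rw [hset, Measure.count_apply_finset, Fin.card_filter_val_lt, ENNReal.ofReal_natCast,
      min_eq_right (by omega)]
  have hxe : (n : ENNReal) * μ (Set.Ioi t) = ENNReal.ofReal x := by
    rw [hx, ENNReal.ofReal_mul (Nat.cast_nonneg n), ENNReal.ofReal_natCast,
      ofReal_measureReal]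
  rw [hcard, hxe]
  constructor
  · refine ENNReal.ofReal_le_ofReal ?_
    obtain h0 | h0 := Nat.eq_zero_or_pos ⌈x⌉₊
    · rw [h0]; simpa using hx0
    · rw [Nat.cast_sub h0]
      have := Nat.ceil_lt_add_one hx0
      push_cast
      linarith
  · rw [← ENNReal.ofReal_one, ← ENNReal.ofReal_add (Nat.cast_nonneg _) zero_le_one]
    refine ENNReal.ofReal_le_ofReal ((Nat.le_ceil x).trans ?_)
    exact_mod_cast (by omega : ⌈x⌉₊ ≤ ⌈x⌉₊ - 1 + 1)

end Quantile

/-! ### Empirical moments against moments of the law, by the layer-cake formula. -/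

section Moments

variable {μ : Measure ℝ}

lemma lintegral_pow_eq {α : Type*} [MeasurableSpace α] (κ : Measure α) {f : α → ℝ}
    (hf0 : 0 ≤ᵐ[κ] f) (hf : AEMeasurable f κ) {k : ℕ} (hk : 0 < k) :
    ∫⁻ x, ENNReal.ofReal (f x ^ k) ∂κ = ENNReal.ofReal k
      * ∫⁻ t in Set.Ioi (0 : ℝ), κ {x | t < f x} * ENNReal.ofReal (t ^ ((k : ℝ) - 1)) := by
  rw [← lintegral_rpow_eq_lintegral_meas_lt_mul κ hf0 hf (by exact_mod_cast hk : (0 : ℝ) < k)]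
  simp_rw [Real.rpow_natCast]

lemma ae_pos (hpos : μ (Set.Iic 0) = 0) : ∀ᵐ x ∂μ, 0 < x := by
  rw [ae_iff]
  simpa [Set.Iic] using hpos

/-- A tail of order `x ^ (-(τ - 1))` with `τ > 4` has a third moment. -/
lemma integrable_cube [IsProbabilityMeasure μ] (hpos : μ (Set.Iic 0) = 0) {τ c : ℝ} (hτ : 4 < τ)
    (htail : ∀ x : ℝ, 0 < x → 1 - cdf μ x ≤ c * x ^ (-(τ - 1))) :
    Integrable (fun x ↦ x ^ 3) μ := by
  have hx := ae_pos hpos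
  refine ⟨by fun_prop, ?_⟩
  have hn : ∫⁻ x, ‖x ^ 3‖ₑ ∂μ = ∫⁻ x, ENNReal.ofReal (x ^ 3) ∂μ := by
    refine lintegral_congr_ae ?_
    filter_upwards [hx] with x hx
    exact Real.enorm_of_nonneg (by positivity)
  rw [hasFiniteIntegral_def, hn,
    lintegral_pow_eq μ (hx.mono fun x hx ↦ hx.le) aemeasurable_id (by norm_num)]
  refine ENNReal.mul_lt_top ENNReal.ofReal_lt_top ?_
  rw [← Set.Ioc_union_Ioi_eq_Ioi zero_le_one]
  refine (lintegral_union_le _ _ _).trans_lt (ENNReal.add_lt_top.2 ⟨?_, ?_⟩)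
  · refine (setLIntegral_mono' (g := fun _ ↦ 1) measurableSet_Ioc fun t ht ↦ ?_).trans_lt
      (by simp)
    refine mul_le_one₀ prob_le_one zero_le ?_
    rw [← ENNReal.ofReal_one]
    exact ENNReal.ofReal_le_ofReal (Real.rpow_le_one ht.1.le ht.2 (by norm_num))
  -- The integrand is of order `t ^ 2 * t ^ (-(τ - 1))`, integrable at infinity precisely because `τ
  -- > 4`.
  · have hint := (integrableOn_Ioi_rpow_of_lt (by linarith : 3 - τ < -1) zero_lt_one).const_mul c
    refine (setLIntegral_mono' (g := fun t ↦ ENNReal.ofReal (c * t ^ (3 - τ)))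
      measurableSet_Ioi fun t ht ↦ ?_).trans_lt hint.lintegral_lt_top
    have ht0 : 0 < t := zero_lt_one.trans ht
    have h := htail t ht0
    rw [one_sub_cdf_eq] at h
    have h2 : μ {x | t < id x} = ENNReal.ofReal (μ.real (Set.Ioi t)) := by
      rw [ofReal_measureReal]; rfl
    calc μ {x | t < id x} * ENNReal.ofReal (t ^ (((3 : ℕ) : ℝ) - 1))
        = ENNReal.ofReal (μ.real (Set.Ioi t) * t ^ (2 : ℝ)) := by
          rw [h2, ENNReal.ofReal_mul measureReal_nonneg]; norm_num
      _ ≤ ENNReal.ofReal (c * t ^ (-(τ - 1)) * t ^ (2 : ℝ)) := by gcongr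
      _ = ENNReal.ofReal (c * t ^ (3 - τ)) := by
          rw [mul_assoc, ← Real.rpow_add ht0]; ring_nf

lemma integrable_pow_of_cube [IsFiniteMeasure μ] (h3 : Integrable (fun x ↦ x ^ 3) μ) {k : ℕ}
    (hk : k ≤ 3) : Integrable (fun x ↦ x ^ k) μ := by
  refine ((integrable_const (1 : ℝ)).add h3.norm).mono' (by fun_prop)
    (Filter.Eventually.of_forall fun x ↦ ?_)
  simp only [norm_pow, Pi.add_apply, Real.norm_eq_abs]
  obtain h | h := le_total |x| 1
  · have := pow_le_one₀ (n := k) (abs_nonneg x) h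
    have := pow_nonneg (abs_nonneg x) 3
    linarith
  · have := pow_le_pow_right₀ h hk
    linarith

lemma tendsto_setIntegral_Ioi_atTop {f : ℝ → ℝ} (hf : Integrable f μ) :
    Filter.Tendsto (fun M ↦ ∫ x in Set.Ioi M, f x ∂μ) Filter.atTop (nhds 0) := by
  have h := tendsto_setIntegral_of_antitone (μ := μ) (f := f) (s := fun M : ℝ ↦ Set.Ioi M)
    (fun _ ↦ measurableSet_Ioi) (fun a b hab ↦ Set.Ioi_subset_Ioi hab) ⟨0, hf.integrableOn⟩
  have he : ⋂ M : ℝ, Set.Ioi M = ∅ := by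
    ext x
    simp only [Set.mem_iInter, Set.mem_Ioi, Set.mem_empty_iff_false, iff_false, not_forall]
    exact ⟨x, lt_irrefl x⟩
  simpa [he] using h

variable [IsProbabilityMeasure μ]

/-- The empirical moments of the weights are at most the moments of the law. -/
lemma sum_weight_pow_le (hpos : μ (Set.Iic 0) = 0) {k : ℕ} (hk : 0 < k)
    (hint : Integrable (fun x ↦ x ^ k) μ) (n : ℕ) :
    ∑ i, weight (cdf μ) n i ^ k ≤ n * lawMoment μ k := by
  have hx := ae_pos hpos
  have hx0 : 0 ≤ᵐ[μ] fun x ↦ x ^ k := hx.mono fun x hx ↦ (pow_pos hx k).le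
  have hw0 : 0 ≤ ∑ i, weight (cdf μ) n i ^ k :=
    Finset.sum_nonneg fun i _ ↦ pow_nonneg (weight_nonneg μ hpos i) k
  have hm0 : 0 ≤ lawMoment μ k := integral_nonneg_of_ae hx0
  rw [← ENNReal.ofReal_le_ofReal_iff (by positivity), ENNReal.ofReal_mul (Nat.cast_nonneg n),
    ENNReal.ofReal_natCast, lawMoment, ofReal_integral_eq_lintegral_ofReal hint hx0,
    ENNReal.ofReal_sum_of_nonneg fun i _ ↦ pow_nonneg (weight_nonneg μ hpos i) k]
  have h1 := lintegral_pow_eq (Measure.count : Measure (Fin n)) (f := weight (cdf μ) n)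
    (Filter.Eventually.of_forall fun i ↦ weight_nonneg μ hpos i)
    (Measurable.of_discrete.aemeasurable) hk
  have h2 := lintegral_pow_eq μ (hx.mono fun x hx ↦ hx.le) aemeasurable_id hk
  rw [lintegral_count, tsum_fintype] at h1
  rw [h1, h2, mul_left_comm, ← lintegral_const_mul' _ _ (ENNReal.natCast_ne_top n)]
  refine mul_le_mul_right (setLIntegral_mono' measurableSet_Ioi fun t ht ↦ ?_) _
  rw [← mul_assoc]
  exact mul_le_mul_left (count_lt_weight μ (Set.mem_Ioi.1 ht).le).1 _

/-- The truncated moments of the law are almost at most the empirical moments of the weights. -/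
lemma integral_min_pow_le (hpos : μ (Set.Iic 0) = 0) {k : ℕ} (hk : 0 < k) (n : ℕ) {M : ℝ}
    (hM : 0 ≤ M) :
    n * ∫ x, min x M ^ k ∂μ ≤ ∑ i, weight (cdf μ) n i ^ k + M ^ k := by
  have hx := ae_pos hpos
  have hmin : 0 ≤ᵐ[μ] fun x ↦ min x M := hx.mono fun x hx ↦ le_min hx.le hM
  have hx0 : 0 ≤ᵐ[μ] fun x ↦ min x M ^ k := hmin.mono fun x hx ↦ pow_nonneg hx k
  have hint : Integrable (fun x ↦ min x M ^ k) μ := by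
    refine (integrable_const (M ^ k)).mono' (by fun_prop) ?_
    filter_upwards [hmin] with x hx
    rw [norm_pow, Real.norm_of_nonneg hx]
    exact pow_le_pow_left₀ hx (min_le_right _ _) k
  have hw0 : 0 ≤ ∑ i, weight (cdf μ) n i ^ k :=
    Finset.sum_nonneg fun i _ ↦ pow_nonneg (weight_nonneg μ hpos i) k
  have hMk : 0 ≤ M ^ k := pow_nonneg hM k
  rw [← ENNReal.ofReal_le_ofReal_iff (by positivity), ENNReal.ofReal_mul (Nat.cast_nonneg n),
    ENNReal.ofReal_natCast, ofReal_integral_eq_lintegral_ofReal hint hx0,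
    ENNReal.ofReal_add hw0 hMk,
    ENNReal.ofReal_sum_of_nonneg fun i _ ↦ pow_nonneg (weight_nonneg μ hpos i) k]
  have h1 := lintegral_pow_eq (Measure.count : Measure (Fin n)) (f := weight (cdf μ) n)
    (Filter.Eventually.of_forall fun i ↦ weight_nonneg μ hpos i)
    (Measurable.of_discrete.aemeasurable) hk
  have h2 := lintegral_pow_eq μ hmin (by fun_prop) hk
  -- The counting error is at most 1 at each level `t < M`. Its layer-cake integral is `M ^ k`, the
  -- moment of the constant `M`.
  have h3 := lintegral_pow_eq (Measure.dirac (0 : ℝ)) (f := fun _ ↦ M)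
    (Filter.Eventually.of_forall fun _ ↦ hM) (by fun_prop) hk
  rw [lintegral_count, tsum_fintype] at h1
  rw [lintegral_const, measure_univ, mul_one] at h3
  rw [h1, h2, h3, mul_left_comm, ← mul_add, ← lintegral_const_mul' _ _ (ENNReal.natCast_ne_top n)]
  have hmeas : Measurable fun t ↦
      Measure.dirac (0 : ℝ) {x | t < M} * ENNReal.ofReal (t ^ ((k : ℝ) - 1)) := by
    refine Measurable.mul (Antitone.measurable fun a b hab ↦ measure_mono ?_) (by fun_prop)
    exact fun x hx ↦ lt_of_le_of_lt hab hx
  refine mul_le_mul_right ((setLIntegral_mono' measurableSet_Ioi fun t ht ↦ ?_).trans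
    (lintegral_add_right _ hmeas).le) _
  rw [← mul_assoc, ← add_mul]
  refine mul_le_mul_left ?_ _
  by_cases htM : t < M
  · have hs : {x | t < min x M} = Set.Ioi t := by ext x; simp [htM]
    have hd : Measure.dirac (0 : ℝ) {x | t < M} = 1 := by simp [htM]
    rw [hs, hd]
    exact (count_lt_weight μ (n := n) (Set.mem_Ioi.1 ht).le).2
  · have hs : {x | t < min x M} = ∅ := by ext x; simp [htM]
    rw [hs, measure_empty, mul_zero]
    exact zero_le

/-- A quantitative lower bound for the first two empirical moments. -/
lemma mul_lawMoment_sub_sum_le (hpos : μ (Set.Iic 0) = 0) (h3 : Integrable (fun x ↦ x ^ 3) μ)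
    {k : ℕ} (hk : 0 < k) (hk2 : k ≤ 2) (n : ℕ) {M : ℝ} (hM : 1 ≤ M) :
    n * lawMoment μ k - ∑ i, weight (cdf μ) n i ^ k
      ≤ M ^ 2 + n * ((∫ x in Set.Ioi M, x ^ 3 ∂μ) / M) := by
  have hM0 : 0 < M := by linarith
  have hx := ae_pos hpos
  have hmin : 0 ≤ᵐ[μ] fun x ↦ min x M := hx.mono fun x hx ↦ le_min hx.le hM0.le
  have hintmin : Integrable (fun x ↦ min x M ^ k) μ := by
    refine (integrable_const (M ^ k)).mono' (by fun_prop) ?_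
    filter_upwards [hmin] with x hx
    rw [norm_pow, Real.norm_of_nonneg hx]
    exact pow_le_pow_left₀ hx (min_le_right _ _) k
  have hle : lawMoment μ k ≤ ∫ x, min x M ^ k ∂μ + (∫ x in Set.Ioi M, x ^ 3 ∂μ) / M := by
    rw [lawMoment, ← integral_indicator measurableSet_Ioi, ← integral_div,
      ← integral_add hintmin ((h3.indicator measurableSet_Ioi).div_const M)]
    refine integral_mono_ae (integrable_pow_of_cube h3 (by omega))
      (hintmin.add ((h3.indicator measurableSet_Ioi).div_const M)) ?_
    filter_upwards [hx] with x hx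
    by_cases hxM : M < x
    · rw [Set.indicator_of_mem (Set.mem_Ioi.2 hxM)]
      have h1 : x ^ k ≤ x ^ 2 := pow_le_pow_right₀ (by linarith) hk2
      have h2 : x ^ 2 ≤ x ^ 3 / M := by
        rw [le_div_iff₀ hM0, pow_succ x 2]
        exact mul_le_mul_of_nonneg_left hxM.le (sq_nonneg x)
      have h4 : 0 ≤ min x M ^ k := pow_nonneg (le_min hx.le hM0.le) k
      linarith
    · rw [Set.indicator_of_notMem (by simpa using hxM), min_eq_left (not_lt.1 hxM)]
      simp
  have h1 := integral_min_pow_le hpos hk n hM0.le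
  have h2 := mul_le_mul_of_nonneg_left hle (Nat.cast_nonneg (α := ℝ) n)
  have h4 : M ^ k ≤ M ^ 2 := pow_le_pow_right₀ hM hk2
  linarith

lemma cube_mul_tail_le (h3 : Integrable (fun x ↦ x ^ 3) μ) {t : ℝ} (ht : 0 ≤ t) :
    t ^ 3 * μ.real (Set.Ioi t) ≤ ∫ x in Set.Ioi t, x ^ 3 ∂μ := by
  have := setIntegral_mono_on (μ := μ) (f := fun _ ↦ t ^ 3) (integrableOn_const (by simp))
    h3.integrableOn measurableSet_Ioi fun x hx ↦ pow_le_pow_left₀ ht (Set.mem_Ioi.1 hx).le 3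
  rw [setIntegral_const, smul_eq_mul] at this
  linarith

end Moments
-- Errors at the scale of the critical window.
section Asymptotics

open Filter Topology

lemma tendsto_cubeRoot : Tendsto (fun n : ℕ ↦ (n : ℝ) ^ (1 / 3 : ℝ)) atTop atTop :=
  (tendsto_rpow_atTop (by norm_num)).comp tendsto_natCast_atTop_atTop

lemma cubeRoot_pow (n : ℕ) : ((n : ℝ) ^ (1 / 3 : ℝ)) ^ 3 = n := by
  rw [← Real.rpow_natCast, ← Real.rpow_mul (Nat.cast_nonneg n)]
  norm_num

variable {μ : Measure ℝ} [IsProbabilityMeasure μ]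

lemma eventually_mul_lawMoment_sub_sum_le (hpos : μ (Set.Iic 0) = 0)
    (h3 : Integrable (fun x ↦ x ^ 3) μ) {k : ℕ} (hk : 0 < k) (hk2 : k ≤ 2) {δ : ℝ} (hδ : 0 < δ) :
    ∀ᶠ n : ℕ in atTop, n * lawMoment μ k - ∑ i, weight (cdf μ) n i ^ k
      ≤ δ * ((n : ℝ) ^ (1 / 3 : ℝ)) ^ 2 := by
  -- Truncating at `M = η n ^ (1/3)` makes `M ^ 2` and the third-moment tail term each at most half
  -- of the allowed error.
  set η := √(δ / 2)
  have hη : 0 < η := by positivity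
  have hη2 : η ^ 2 = δ / 2 := Real.sq_sqrt (by positivity)
  have hM : Tendsto (fun n : ℕ ↦ η * (n : ℝ) ^ (1 / 3 : ℝ)) atTop atTop :=
    tendsto_cubeRoot.const_mul_atTop hη
  have hR := ((tendsto_setIntegral_Ioi_atTop h3).comp hM).eventually_le_const
    (by positivity : 0 < δ / 2 * η)
  filter_upwards [hM.eventually_ge_atTop 1, hR, tendsto_cubeRoot.eventually_gt_atTop 0]
    with n h1 h2 h0
  refine (mul_lawMoment_sub_sum_le hpos h3 hk hk2 n h1).trans ?_
  rw [Function.comp_apply] at h2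
  have hn := cubeRoot_pow n
  set T := (n : ℝ) ^ (1 / 3 : ℝ)
  calc (η * T) ^ 2 + n * ((∫ x in Set.Ioi (η * T), x ^ 3 ∂μ) / (η * T))
      ≤ (η * T) ^ 2 + n * (δ / 2 * η / (η * T)) := by gcongr
    _ = δ * T ^ 2 := by rw [← hn, mul_pow, hη2]; field_simp; ring

/-- A finite third moment forces `n * P(W > η n ^ (1/3))` to 0, while a larger weight would need it
to exceed 1. -/
lemma eventually_weight_le (h3 : Integrable (fun x ↦ x ^ 3) μ) {η : ℝ} (hη : 0 < η) :
    ∀ᶠ n : ℕ in atTop, ∀ i, weight (cdf μ) n i ≤ η * (n : ℝ) ^ (1 / 3 : ℝ) := by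
  have hM : Tendsto (fun n : ℕ ↦ η * (n : ℝ) ^ (1 / 3 : ℝ)) atTop atTop :=
    tendsto_cubeRoot.const_mul_atTop hη
  have hR := ((tendsto_setIntegral_Ioi_atTop h3).comp hM).eventually_le_const
    (by positivity : 0 < η ^ 3)
  filter_upwards [hR] with n h2 i
  rw [Function.comp_apply] at h2
  by_contra! hcon
  have ht : 0 ≤ η * (n : ℝ) ^ (1 / 3 : ℝ) := by positivity
  have h1 := (lt_weight_iff μ i ht).1 hcon
  have h4 := (cube_mul_tail_le h3 ht).trans h2
  rw [mul_pow, cubeRoot_pow, mul_assoc] at h4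
  have h5 := le_of_mul_le_mul_left (h4.trans (mul_one _).symm.le) (by positivity)
  have : (0 : ℝ) ≤ i := Nat.cast_nonneg _
  linarith

lemma lawMoment_two_eq_one {μ : Measure ℝ} (hcrit : lawMoment μ 2 / lawMoment μ 1 = 1) :
    lawMoment μ 2 = lawMoment μ 1 :=
  (div_eq_one_iff_eq fun h ↦ by simp [h] at hcrit).1 hcrit

lemma lawMoment_one_pos {μ : Measure ℝ} (hpos : μ (Set.Iic 0) = 0)
    (hcrit : lawMoment μ 2 / lawMoment μ 1 = 1) : 0 < lawMoment μ 1 := by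
  refine lt_of_le_of_ne (integral_nonneg_of_ae ?_) fun h ↦ by simp [← h] at hcrit
  filter_upwards [ae_pos hpos] with x hx
  simpa using hx.le

/-- Expand `E (W - 1) ^ 2 ≥ 0` with `E W ^ 2 = E W`. -/
lemma lawMoment_one_le (h3 : Integrable (fun x ↦ x ^ 3) μ)
    (hcrit : lawMoment μ 2 / lawMoment μ 1 = 1) : lawMoment μ 1 ≤ 1 := by
  have h1 := integrable_pow_of_cube h3 (k := 1) (by norm_num)
  have h2 := integrable_pow_of_cube h3 (k := 2) (by norm_num)
  have h : 0 ≤ ∫ x, (x ^ 2 - 2 * x ^ 1 + 1) ∂μ :=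
    integral_nonneg fun x ↦ by
      simp only [Pi.zero_apply, pow_one]
      nlinarith [sq_nonneg (x - 1)]
  rw [integral_add (f := fun x ↦ x ^ 2 - 2 * x ^ 1) (h2.sub (h1.const_mul 2)) (integrable_const 1),
    integral_sub h2 (h1.const_mul 2), integral_const_mul] at h
  have h4 := lawMoment_two_eq_one hcrit
  simp only [lawMoment] at h4 ⊢
  simp only [integral_const, probReal_univ, smul_eq_mul, mul_one] at h
  linarith

end Asymptotics

/-! ### The tail bound for nearly critical weights, then for the given law. -/

section Tail

variable {n : ℕ}

lemma edgeProb_mk {w : Fin n → ℝ} (hw : ∀ v, 0 ≤ w v) (u v : Fin n) :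
    (edgeProb w s(u, v) : ℝ) = 1 - Real.exp (-(w u * w v / ∑ v, w v)) := by
  have h : 0 ≤ w u * w v / ∑ v, w v :=
    div_nonneg (mul_nonneg (hw u) (hw v)) (Finset.sum_nonneg fun v _ ↦ hw v)
  rw [edgeProb, Sym2.map_mk, Sym2.mul_mk, totalWeight, Set.projIcc_of_mem]
  exact ⟨by simpa using h, by linarith [Real.exp_pos (-(w u * w v / ∑ v, w v))]⟩

lemma one_le_mul_sq_one_sub_exp {s : ℝ} (hs : 0 < s) :
    1 ≤ (1.34 : ℝ) * (1 - Real.exp (-(2 * s ^ 2)) ^ (⌊1 / s ^ 2⌋₊ + 1)) ^ 2 := by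
  have h1 : Real.exp (-(2 * s ^ 2)) ^ (⌊1 / s ^ 2⌋₊ + 1) ≤ Real.exp (-2) := by
    rw [← Real.exp_nat_mul, Real.exp_le_exp]
    have h := (Nat.lt_floor_add_one (1 / s ^ 2)).le
    rw [div_le_iff₀ (by positivity)] at h
    push_cast
    linarith
  have h2 : Real.exp (-2) ≤ 0.1356 := by
    have h : Real.exp (-2) = Real.exp (-1) ^ 2 := by rw [← Real.exp_nat_mul]; norm_num
    rw [h]
    have h3 := Real.exp_neg_one_lt_d9
    have h4 := Real.exp_pos (-1)
    nlinarith
  nlinarith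

/-- The tail bound for the largest cluster at weights that are nearly critical at scale `s`. -/
theorem graphLaw_tail_le {w : Fin n → ℝ} (hw : ∀ v, 0 ≤ w v) (hl : 0 < ∑ v, w v) {W s : ℝ}
    (hW : ∀ v, w v ≤ W) (hs : 0 < s) (hs1 : s ≤ 1 / 1000) (hWs : W * s ≤ 1 / 1000)
    (hWl : W ^ 2 / ∑ v, w v ≤ s / 500) (hln : ∑ v, w v ≤ n)
    (hν : |(∑ u, w u ^ 2) / (∑ v, w v) - 1| ≤ s / 1000) :
    (graphLaw w).real {G | 1 / s ^ 2 < (maxClusterSize G : ℝ)} ≤ 2 * s ^ 3 * n := by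
  have h1 := maxClusterSize_tail_mul_le w (x := 1 / s ^ 2) (by positivity)
  have h2 : ∑ v, (edgeLaw (edgeProb w)).real
      {ξ | ⌊1 / s ^ 2⌋₊ < (explored ξ Finset.univ {v}).ncard} ≤ 1.34 * (1.22 * s * n) := by
    have h3 := sum_progeny_le hw hl (edgeProb_mk hw) hW hs hs1 hWs hWl (by simpa using hln) hν
    rw [Fintype.card_fin] at h3
    refine le_trans ?_ (mul_le_mul_of_nonneg_left h3 (by norm_num))
    rw [Finset.mul_sum]
    exact Finset.sum_le_sum fun v _ ↦ explored_tail_le _ v (Real.exp_pos _).le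
      (Real.exp_le_one_iff.2 (by nlinarith)) (by norm_num) (one_le_mul_sq_one_sub_exp hs)
  have h3 := h1.trans h2
  rw [mul_one_div, div_le_iff₀ (by positivity)] at h3
  refine h3.trans ?_
  have : 0 ≤ s ^ 3 * n := by positivity
  calc 1.34 * (1.22 * s * n) * s ^ 2 = 1.34 * 1.22 * (s ^ 3 * n) := by ring
    -- The product `1.34 * 1.22 ≈ 1.63` leaves room below 2.
    _ ≤ 2 * (s ^ 3 * n) := by gcongr; norm_num
    _ = _ := by ring

end Tail

open Filter in
/-- At criticality, the constant `2` is valid for every fixed `ω = r ^ 2` and large `n`. -/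
theorem eventually_graphLaw_tail_le {μ : Measure ℝ} [IsProbabilityMeasure μ]
    (hpos : μ (Set.Iic 0) = 0) (hcrit : lawMoment μ 2 / lawMoment μ 1 = 1)
    (h3 : Integrable (fun x ↦ x ^ 3) μ) {r : ℝ} (hr : 1 ≤ r) :
    ∀ᶠ n : ℕ in atTop, (graphLaw (weight (cdf μ) n)).real
      {G | r ^ 2 * ((n : ℝ) ^ (1 / 3 : ℝ)) ^ 2 < (maxClusterSize G : ℝ)} ≤ 2 / r ^ 3 := by
  have hr0 : 0 < r := by linarith
  have hm := lawMoment_one_pos hpos hcrit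
  have hm1 := lawMoment_one_le h3 hcrit
  have hm2 := lawMoment_two_eq_one hcrit
  set m := lawMoment μ 1
  -- With `l ≥ n m / 2` and `s = 1 / (r n ^ (1/3))`, these `δ` and `η` give exactly the margins `s /
  -- 1000` and `s / 500` of `graphLaw_tail_le`.
  obtain ⟨δ, hδ⟩ : ∃ δ, δ = m / (2000 * r) := ⟨_, rfl⟩
  have hδ0 : 0 < δ := by rw [hδ]; positivity
  obtain ⟨η, hη⟩ : ∃ η, η = m / (1000 * r) := ⟨_, rfl⟩
  have hη0 : 0 < η := by rw [hη]; positivity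
  filter_upwards [eventually_mul_lawMoment_sub_sum_le hpos h3 (k := 1) one_pos one_le_two hδ0,
    eventually_mul_lawMoment_sub_sum_le hpos h3 (k := 2) two_pos le_rfl hδ0,
    eventually_weight_le h3 hη0, tendsto_cubeRoot.eventually_ge_atTop 1000]
    with n hl1 hl2 hmax hT
  have hup1 := sum_weight_pow_le hpos one_pos (integrable_pow_of_cube h3 (by norm_num)) n
  have hup2 := sum_weight_pow_le hpos two_pos (integrable_pow_of_cube h3 (by norm_num)) n
  simp only [pow_one] at hl1 hup1
  have hw := fun i ↦ weight_nonneg μ hpos (n := n) i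
  have hn := cubeRoot_pow n
  change _ ≤ n * m at hup1
  change n * m - _ ≤ _ at hl1
  rw [hm2] at hl2 hup2
  generalize (n : ℝ) ^ (1 / 3 : ℝ) = T at *
  have hT0 : 0 < T := by linarith
  obtain ⟨l, hl⟩ : ∃ l, l = ∑ i, weight (cdf μ) n i := ⟨_, rfl⟩
  obtain ⟨Q, hQ⟩ : ∃ Q, Q = ∑ i, weight (cdf μ) n i ^ 2 := ⟨_, rfl⟩
  rw [← hl] at hl1 hup1
  rw [← hQ] at hl2 hup2
  rw [← hn] at hl1 hl2 hup1 hup2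
  have hδT : δ * T ^ 2 ≤ T ^ 3 * m / 2 := by
    have : δ ≤ m := by rw [hδ]; exact div_le_self hm.le (by linarith)
    calc δ * T ^ 2 ≤ m * T ^ 2 := by gcongr
      _ ≤ m * T ^ 2 * (T / 2) := le_mul_of_one_le_right (by positivity) (by linarith)
      _ = _ := by ring
  have hlhalf : T ^ 3 * m / 2 ≤ l := by linarith
  have hl0 : 0 < l := lt_of_lt_of_le (by positivity) hlhalf
  have hs : (0 : ℝ) < 1 / (r * T) := by positivity
  have hrT : T ≤ r * T := le_mul_of_one_le_left hT0.le hr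
  have key := graphLaw_tail_le (W := η * T) (s := 1 / (r * T)) hw (hl ▸ hl0) hmax hs
    (one_div_le_one_div_of_le (by norm_num) (hT.trans hrT)) ?_ ?_ ?_ ?_
  · rw [show 1 / (1 / (r * T)) ^ 2 = r ^ 2 * T ^ 2 by field_simp] at key
    refine key.trans_eq ?_
    rw [← hn]
    field_simp
  · rw [show η * T * (1 / (r * T)) = η / r by field_simp, hη, div_div,
      div_le_div_iff₀ (by positivity) (by norm_num)]
    nlinarith
  · rw [← hl, div_le_iff₀ hl0]
    calc (η * T) ^ 2 ≤ η * T ^ 2 := by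
          rw [mul_pow]
          have : η ≤ 1 := by
            rw [hη, div_le_one (by positivity)]; linarith
          gcongr
          nlinarith
      _ = 1 / (r * T) / 500 * (T ^ 3 * m / 2) := by rw [hη]; field_simp; norm_num
      _ ≤ 1 / (r * T) / 500 * l := by gcongr
  · rw [← hl, ← hn]
    exact hup1.trans (mul_le_of_le_one_right (by positivity) hm1)
  · rw [← hl, ← hQ, div_sub_one hl0.ne', abs_div, abs_of_pos hl0, div_le_iff₀ hl0]
    calc |Q - l| ≤ δ * T ^ 2 := abs_le.2 ⟨by linarith, by linarith⟩
      _ = 1 / (r * T) / 1000 * (T ^ 3 * m / 2) := by rw [hδ]; field_simp; norm_num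
      _ ≤ 1 / (r * T) / 1000 * l := by gcongr

end NorrosReittu

/-- `μ` is the law of the weight variable `W`, and `F = cdf μ` is its distribution function. -/
theorem theorem3p1 (μ : Measure ℝ) [IsProbabilityMeasure μ]
    (hpos : μ (Set.Iic 0) = 0)
    (hcrit : NorrosReittu.lawMoment μ 2 / NorrosReittu.lawMoment μ 1 = 1)
    (τ cF : ℝ) (hτ : 4 < τ) (hcF : 0 < cF)
    (htail : ∀ x : ℝ, 0 < x → 1 - cdf μ x ≤ cF * x ^ (-(τ - 1))) :
    ∃ C : ℝ, 0 < C ∧ ∀ ω : ℝ, 1 < ω → ∃ N : ℕ, ∀ n : ℕ, N ≤ n →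
      (NorrosReittu.graphLaw (NorrosReittu.weight (cdf μ) n)).real
          {G | ω * (n : ℝ) ^ (2 / 3 : ℝ) < (NorrosReittu.maxClusterSize G : ℝ)}
        ≤ 2 / ω ^ (3 / 2 : ℝ)
          * max (NorrosReittu.lawMoment μ 1 / NorrosReittu.lawMoment μ 3) 1
          * (1 + C * (ω ^ (-(1 / 2) : ℝ) * (n : ℝ) ^ (-((τ - 4) / (3 * (τ - 1)))))) := by
  -- Any positive constant would do, since the bound already holds without the correction.
  refine ⟨1, one_pos, fun ω hω ↦ ?_⟩
  have hω0 : 0 < ω := by linarith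
  obtain ⟨N, hN⟩ := Filter.eventually_atTop.1
    (NorrosReittu.eventually_graphLaw_tail_le hpos hcrit
      (NorrosReittu.integrable_cube hpos hτ htail) (Real.one_le_sqrt.2 hω.le))
  refine ⟨N, fun n hn ↦ ?_⟩
  have h := hN n hn
  have h2 : ((n : ℝ) ^ (1 / 3 : ℝ)) ^ 2 = (n : ℝ) ^ (2 / 3 : ℝ) := by
    rw [← Real.rpow_natCast, ← Real.rpow_mul (Nat.cast_nonneg n)]
    norm_num
  have h3 : √ω ^ 3 = ω ^ (3 / 2 : ℝ) := by
    rw [Real.sqrt_eq_rpow, ← Real.rpow_natCast, ← Real.rpow_mul hω0.le]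
    norm_num
  rw [h2, h3, Real.sq_sqrt hω0.le] at h
  refine h.trans ?_
  rw [mul_assoc]
  refine le_mul_of_one_le_right (by positivity) (one_le_mul_of_one_le_of_one_le
    (le_max_right _ _) (le_add_of_nonneg_right ?_))
  positivity
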